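/- Let $n\ge 1$ and $\lambda_1,\dots,\lambda_n\in\mathbb R$. Let $H_{n+1}=\mathbb C^n\times\mathbb R$ with coordinates $(z,x_{2n+1})$, $z_j=x_{2j-1}+ix_{2j}$, carry the CR structure $T^{1,0}H_{n+1}$ spanned over $\mathbb C$ by $$Z_j=\frac{\partial}{\partial z_j}-i\lambda_j\overline z_j\frac{\partial}{\partial x_{2n+1}},\qquad j=1,\dots,n,$$ and the Hermitian metric on $\mathbb C TH_{n+1}$ for which $Z_1,\dots,Z_n,\overline Z_1,\dots,\overline Z_n,T=-\partial/\partial x_{2n+1}$ are orthonormal. Its volume form is $2^n\,dx_1\cdots dx_{2n+1}$, and the forms $d\overline z^J=d\overline z_{j_1}\wedge\dots\wedge d\overline z_{j_q}$, $J=(j_1<\dots<j_q)$, are an orthonormal frame of the bundle of $(0,q)$-forms. Let $L^2_{(0,q)}(H_{n+1})$ be the corresponding space of square integrable $(0,q)$-forms. Let $$\overline\partial_b\Big(\sum_{|J|=q}u_J\,d\overline z^J\Big)=\sum_{|J|=q}\sum_{k=1}^n(\overline Z_ku_J)\,d\overline z_k\wedge d\overline z^J$$ be the tangential Cauchy–Riemann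 operator, extended in the sense of distributions to the domain $\{u\in L^2_{(0,q)}(H_{n+1}):\overline\partial_bu\in L^2_{(0,q+1)}(H_{n+1})\}$, and let $\overline\partial_b^*$ be its Hilbert space adjoint. For $0\le q\le n$ let $\Box_b^{(q)}=\overline\partial_b\overline\partial_b^*+\overline\partial_b^*\overline\partial_b$ be the Kohn Laplacian (Gaffney extension) with domain $$\{u\in\operatorname{Dom}\overline\partial_b\cap\operatorname{Dom}\overline\partial_b^*:\ \overline\partial_bu\in\operatorname{Dom}\overline\partial_b^*,\ \overline\partial_b^*u\in\operatorname{Dom}\overline\partial_b\}\subset L^2_{(0,q)}(H_{n+1}),$$ where for $q=0$ the operator $\overline\partial_b^*$ on functions is zero. Put $\mathcal H^q_b(H_{n+1})=\operatorname{Ker}\Box_b^{(q)}$. 1. If $\lambda_j=0$ for some $j$, then $\mathcal H^q_b(H_{n+1})=\{0\}$ for every $q\in\{0,\dots,n\}$. 2. Suppose that all $\lambda_j$ are non-zero, and let $n_-$ be the number of negative $\lambda_j$ and $n_+$ the number of positive $\lambda_j$. If $q\in\{0,\dots,n\}$ and $q\notin\{n_-,n_+\}$, then $\mathcal H^q_b(H_{n+1})=\{0\}$.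 -/

import Mathlib

open MeasureTheory
open scoped ENNReal ContDiff

noncomputable section

namespace Heisenberg

/-- The Heisenberg group `H_{n+1} = ℂⁿ × ℝ` as a manifold, with points `x = (z, t)`; in the real
coordinates `z_j = x_{2j-1} + i x_{2j}` and `t = x_{2n+1}`. -/
abbrev H (n : ℕ) : Type := (Fin n → ℂ) × ℝ

/-- The volume measure `2ⁿ dx_1 ⋯ dx_{2n+1}` of the Hermitian metric for which the `Z_j`, the
`conj Z_j` and `T = -∂/∂t` are orthonormal. -/
def vol (n : ℕ) : Measure (H n) := (2 : ℝ≥0∞) ^ n • volume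

/-- `∂/∂x_{2j-1}`, the derivative in the real part of `z_j`. -/
def dRe {n : ℕ} (j : Fin n) (f : H n → ℂ) (x : H n) : ℂ := fderiv ℝ f x (Pi.single j 1, 0)

/-- `∂/∂x_{2j}`, the derivative in the imaginary part of `z_j`. -/
def dIm {n : ℕ} (j : Fin n) (f : H n → ℂ) (x : H n) : ℂ :=
  fderiv ℝ f x (Pi.single j Complex.I, 0)

/-- `∂/∂x_{2n+1}`. -/
def dT {n : ℕ} (f : H n → ℂ) (x : H n) : ℂ := fderiv ℝ f x (0, 1)

/-- `∂/∂z̄_j = (∂/∂x_{2j-1} + i ∂/∂x_{2j}) / 2`. -/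
def dZbar {n : ℕ} (j : Fin n) (f : H n → ℂ) (x : H n) : ℂ :=
  (1 / 2 : ℂ) * (dRe j f x + Complex.I * dIm j f x)

/-- The vector field `conj Z_j = ∂/∂z̄_j + i λ_j z_j ∂/∂x_{2n+1}`, the complex conjugate of
`Z_j = ∂/∂z_j - i λ_j z̄_j ∂/∂x_{2n+1}`. The fields `conj Z_1, …, conj Z_n` span `T^{0,1}`. -/
def Zbar {n : ℕ} (lam : Fin n → ℝ) (j : Fin n) (f : H n → ℂ) (x : H n) : ℂ :=
  dZbar j f x + Complex.I * (lam j : ℂ) * x.1 j * dT f x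

/-- Strictly increasing multi-indices `J = (j_1 < ⋯ < j_q)` with entries in `{1, …, n}`,
as `q`-element sets. -/
abbrev MultiIndex (n q : ℕ) : Type := {J : Finset (Fin n) // J.card = q}

/-- The fibre of `Λ^q T^{*0,1}`: the vector `(a_J)_J` stands for `∑'_J a_J dz̄^J`. Since
`dz̄_1, …, dz̄_n` is dual to the orthonormal frame `conj Z_1, …, conj Z_n`, the forms `dz̄^J`
are an orthonormal basis of the fibre. -/
abbrev Fibre (n q : ℕ) : Type := EuclideanSpace ℂ (MultiIndex n q)

/-- The Hilbert space `L²_{(0,q)}(H_{n+1})` of square integrable `(0,q)`-forms. -/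
abbrev L2Form (n q : ℕ) : Type := Lp (Fibre n q) 2 (vol n)

/-- The coefficient `u_J` of `u = ∑'_J u_J dz̄^J`. -/
def coeff {n q : ℕ} (u : L2Form n q) (J : MultiIndex n q) : H n → ℂ := fun x => u x J

/-- Removing an entry `k` from a multi-index `K`. -/
def MultiIndex.erase {n q : ℕ} (K : MultiIndex n (q + 1)) (k : {k // k ∈ K.1}) :
    MultiIndex n q :=
  ⟨K.1.erase k.1, by rw [Finset.card_erase_of_mem k.2, K.2]; rfl⟩

/-- The `dz̄^K`-coefficient of `∑_k ∑'_J D_k(u_J) dz̄_k ∧ dz̄^J`. A pair `(k, J)` contributes to it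
only if `k ∉ J` and `K = J ∪ {k}`, and then `dz̄_k ∧ dz̄^J = (-1)^m dz̄^K`, where `m` is the number
of entries of `K` smaller than `k`. -/
def wedgeSum {n q : ℕ} {A B : Type*} [AddCommGroup B] (D : Fin n → A → B)
    (u : MultiIndex n q → A) (K : MultiIndex n (q + 1)) : B :=
  ∑ k : {k // k ∈ K.1}, (-1 : ℤ) ^ (K.1.filter (fun j => j < k.1)).card • D k.1 (u (K.erase k))

/-- The tangential Cauchy-Riemann operator on smooth forms (given by their coefficients):
`∂̄_b u = ∑_k ∑'_J (conj Z_k u_J) dz̄_k ∧ dz̄^J`. -/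
def dbarSmooth {n q : ℕ} (lam : Fin n → ℝ) (u : MultiIndex n q → H n → ℂ) :
    MultiIndex n (q + 1) → H n → ℂ :=
  wedgeSum (Zbar lam) u

/-- Test functions: smooth functions with compact support. -/
def IsTest {n : ℕ} (φ : H n → ℂ) : Prop := ContDiff ℝ ∞ φ ∧ HasCompactSupport φ

/-- The distribution `φ ↦ ∫ f φ dμ` defined by a locally integrable function `f`. -/
def toDist {n : ℕ} (f : H n → ℂ) (φ : H n → ℂ) : ℂ := ∫ x, f x * φ x ∂vol n

/-- The distributional derivative `conj Z_k f`, i.e. `φ ↦ -∫ f (conj Z_k φ) dμ`. (The transpose of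
`conj Z_k` is `-conj Z_k`, as `z_k` does not depend on `x_{2n+1}`.) -/
def distZbar {n : ℕ} (lam : Fin n → ℝ) (k : Fin n) (f : H n → ℂ) (φ : H n → ℂ) : ℂ :=
  -∫ x, f x * Zbar lam k φ x ∂vol n

/-- For `u ∈ L²_{(0,q)}` and `v ∈ L²_{(0,q+1)}`: `∂̄_b u = v` in the sense of distributions. -/
def IsWeakDbar {n q : ℕ} (lam : Fin n → ℝ) (u : L2Form n q) (v : L2Form n (q + 1)) : Prop :=
  ∀ (K : MultiIndex n (q + 1)) (φ : H n → ℂ), IsTest φ →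
    wedgeSum (distZbar lam) (coeff u) K φ = toDist (coeff v K) φ

lemma memLp_coeff {n q : ℕ} (u : L2Form n q) (J : MultiIndex n q) :
    MemLp (coeff u J) 2 (vol n) :=
  (EuclideanSpace.proj J : Fibre n q →L[ℂ] ℂ).comp_memLp' (Lp.memLp u)

lemma coeff_add {n q : ℕ} (u v : L2Form n q) (J : MultiIndex n q) :
    coeff (u + v) J =ᵐ[vol n] fun x => coeff u J x + coeff v J x := by
  filter_upwards [Lp.coeFn_add u v] with x hx
  simp only [coeff]
  rw [hx]
  simp

lemma coeff_smul {n q : ℕ} (c : ℂ) (u : L2Form n q) (J : MultiIndex n q) :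
    coeff (c • u) J =ᵐ[vol n] fun x => c * coeff u J x := by
  filter_upwards [Lp.coeFn_smul c u] with x hx
  simp only [coeff]
  rw [hx]
  simp

instance (n : ℕ) : IsFiniteMeasureOnCompacts (vol n) where
  lt_top_of_isCompact := fun K hK => by
    simp only [vol, Measure.smul_apply, smul_eq_mul]
    exact ENNReal.mul_lt_top (ENNReal.pow_lt_top (by simp)) hK.measure_lt_top

lemma memLp_test {n : ℕ} {ψ : H n → ℂ} (h : Continuous ψ) (hs : HasCompactSupport ψ) :
    MemLp ψ 2 (vol n) := h.memLp_of_hasCompactSupport hs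

lemma IsTest.zbar {n : ℕ} (lam : Fin n → ℝ) (k : Fin n) {φ : H n → ℂ} (h : IsTest φ) :
    Continuous (Zbar lam k φ) ∧ HasCompactSupport (Zbar lam k φ) := by
  have hc : Continuous (fderiv ℝ φ) := h.1.continuous_fderiv (by simp)
  refine ⟨?_, ?_⟩
  · unfold Zbar dZbar dRe dIm dT
    fun_prop
  · refine (h.2.fderiv (𝕜 := ℝ)).mono ?_
    intro x hx
    contrapose! hx
    simp only [Function.mem_support, not_not] at hx
    simp [Zbar, dZbar, dRe, dIm, dT, hx]

lemma integrable_pair {n : ℕ} {f ψ : H n → ℂ} (hf : MemLp f 2 (vol n)) (h : Continuous ψ)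
    (hs : HasCompactSupport ψ) : Integrable (fun x => f x * ψ x) (vol n) :=
  hf.integrable_mul (memLp_test h hs)

lemma integral_coeff_add {n q : ℕ} (u v : L2Form n q) (J : MultiIndex n q) {ψ : H n → ℂ}
    (h : Continuous ψ) (hs : HasCompactSupport ψ) :
    ∫ x, coeff (u + v) J x * ψ x ∂vol n =
      ∫ x, coeff u J x * ψ x ∂vol n + ∫ x, coeff v J x * ψ x ∂vol n := by
  rw [← integral_add (integrable_pair (memLp_coeff u J) h hs)
    (integrable_pair (memLp_coeff v J) h hs)]
  refine integral_congr_ae ?_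
  filter_upwards [coeff_add u v J] with x hx
  rw [hx, add_mul]

lemma integral_coeff_smul {n q : ℕ} (c : ℂ) (u : L2Form n q) (J : MultiIndex n q) (ψ : H n → ℂ) :
    ∫ x, coeff (c • u) J x * ψ x ∂vol n = c * ∫ x, coeff u J x * ψ x ∂vol n := by
  rw [← integral_const_mul]
  refine integral_congr_ae ?_
  filter_upwards [coeff_smul c u J] with x hx
  rw [hx, mul_assoc]

instance (n : ℕ) : (vol n).IsAddHaarMeasure :=
  haveI : (volume : Measure (H n)).IsAddHaarMeasure :=
    haveI h1 : (volume : Measure (Fin n → ℂ)).IsAddHaarMeasure :=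
      inferInstanceAs ((Measure.pi fun _ => (volume : Measure ℂ)).IsAddHaarMeasure)
    inferInstanceAs (((volume : Measure (Fin n → ℂ)).prod (volume : Measure ℝ)).IsAddHaarMeasure)
  Measure.IsAddHaarMeasure.smul _ (by simp) (ENNReal.pow_ne_top (by simp))

lemma toDist_Zbar {n : ℕ} (lam : Fin n → ℝ) (k : Fin n) {f φ : H n → ℂ} (hf : ContDiff ℝ ∞ f)
    (hφ : IsTest φ) : toDist (Zbar lam k f) φ = distZbar lam k f φ := by
  have hfc : Continuous f := hf.continuous
  have hφc : Continuous φ := hφ.1.continuous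
  have hf' : Continuous (fderiv ℝ f) := hf.continuous_fderiv (by simp)
  have hφ' : Continuous (fderiv ℝ φ) := hφ.1.continuous_fderiv (by simp)
  have hs' : ∀ v, HasCompactSupport (fun x => fderiv ℝ φ x v) := fun v =>
    hφ.2.fderiv_apply (𝕜 := ℝ) v
  -- integration by parts for a constant vector field
  have ibp : ∀ (v : H n) (g : H n → ℂ), ContDiff ℝ ∞ g →
      Integrable (fun x => g x * fderiv ℝ φ x v) (vol n) ∧
      Integrable (fun x => fderiv ℝ g x v * φ x) (vol n) ∧
      ∫ x, g x * fderiv ℝ φ x v ∂vol n = -∫ x, fderiv ℝ g x v * φ x ∂vol n := by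
    intro v g hg
    have hgc : Continuous g := hg.continuous
    have hg' : Continuous (fderiv ℝ g) := hg.continuous_fderiv (by simp)
    have i1 : Integrable (fun x => g x * fderiv ℝ φ x v) (vol n) :=
      Continuous.integrable_of_hasCompactSupport (by fun_prop) ((hs' v).mul_left)
    have i2 : Integrable (fun x => fderiv ℝ g x v * φ x) (vol n) :=
      Continuous.integrable_of_hasCompactSupport (by fun_prop) (hφ.2.mul_left)
    refine ⟨i1, i2, integral_mul_fderiv_eq_neg_fderiv_mul_of_integrable i2 i1 ?_ ?_ ?_⟩
    · exact Continuous.integrable_of_hasCompactSupport (by fun_prop) (hφ.2.mul_left)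
    · exact fun x _ => hg.differentiable (by simp) x
    · exact fun x _ => hφ.1.differentiable (by simp) x
  have hz : ContDiff ℝ ∞ (fun x : H n => x.1 k) := by fun_prop
  have hzf : ContDiff ℝ ∞ (fun x : H n => x.1 k * f x) := hz.mul hf
  have dz : ∀ x, fderiv ℝ (fun x : H n => x.1 k * f x) x (0, 1) = x.1 k * fderiv ℝ f x (0, 1) := by
    intro x
    have h1 : HasFDerivAt (fun x : H n => x.1 k)
        ((ContinuousLinearMap.proj (R := ℝ) (φ := fun _ : Fin n => ℂ) k).comp
          (ContinuousLinearMap.fst ℝ (Fin n → ℂ) ℝ)) x :=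
      ((ContinuousLinearMap.proj (R := ℝ) (φ := fun _ : Fin n => ℂ) k).comp
          (ContinuousLinearMap.fst ℝ (Fin n → ℂ) ℝ)).hasFDerivAt
    rw [show (fun x : H n => x.1 k * f x) = (fun x : H n => x.1 k) * f from rfl,
      (h1.mul (hf.differentiable (by simp) x).hasFDerivAt).fderiv]
    simp
  obtain ⟨a1, a2, a3⟩ := ibp (Pi.single k 1, 0) f hf
  obtain ⟨b1, b2, b3⟩ := ibp (Pi.single k Complex.I, 0) f hf
  obtain ⟨c1, c2, c3⟩ := ibp (0, 1) _ hzf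
  simp only [dz] at c2 c3
  have e1 : (fun x => Zbar lam k f x * φ x) = fun x =>
      (1 / 2 : ℂ) * (fderiv ℝ f x (Pi.single k 1, 0) * φ x)
      + (1 / 2 : ℂ) * Complex.I * (fderiv ℝ f x (Pi.single k Complex.I, 0) * φ x)
      + Complex.I * lam k * (x.1 k * fderiv ℝ f x (0, 1) * φ x) := by
    funext x; simp only [Zbar, dZbar, dRe, dIm, dT]; ring
  have e2 : (fun x => f x * Zbar lam k φ x) = fun x =>
      (1 / 2 : ℂ) * (f x * fderiv ℝ φ x (Pi.single k 1, 0))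
      + (1 / 2 : ℂ) * Complex.I * (f x * fderiv ℝ φ x (Pi.single k Complex.I, 0))
      + Complex.I * lam k * (x.1 k * f x * fderiv ℝ φ x (0, 1)) := by
    funext x; simp only [Zbar, dZbar, dRe, dIm, dT]; ring
  have split : ∀ {A B C : H n → ℂ} (a b c : ℂ), Integrable A (vol n) → Integrable B (vol n) →
      Integrable C (vol n) → ∫ x, a * A x + b * B x + c * C x ∂vol n =
        a * ∫ x, A x ∂vol n + b * ∫ x, B x ∂vol n + c * ∫ x, C x ∂vol n := by
    intro A B C a b c hA hB hC
    rw [integral_add (f := fun x => a * A x + b * B x) ((hA.const_mul a).add (hB.const_mul b))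
      (hC.const_mul c), integral_add (hA.const_mul a) (hB.const_mul b)]
    simp only [integral_const_mul]
  rw [toDist, distZbar, e1, e2, split _ _ _ a2 b2 c2, split _ _ _ a1 b1 c1]
  simp only [a3, b3, c3]
  ring

/-- On smooth forms the distributional `∂̄_b` is the classical one. -/
lemma toDist_dbarSmooth {n q : ℕ} (lam : Fin n → ℝ) {u : MultiIndex n q → H n → ℂ}
    (hu : ∀ J, ContDiff ℝ ∞ (u J)) (K : MultiIndex n (q + 1)) {φ : H n → ℂ} (hφ : IsTest φ) :
    toDist (dbarSmooth lam u K) φ = wedgeSum (distZbar lam) u K φ := by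
  have hi : ∀ (k : Fin n) (J : MultiIndex n q),
      Integrable (fun x => Zbar lam k (u J) x * φ x) (vol n) := by
    intro k J
    have h1 : Continuous (fderiv ℝ (u J)) := (hu J).continuous_fderiv (by simp)
    have h2 : Continuous φ := hφ.1.continuous
    refine Continuous.integrable_of_hasCompactSupport ?_ (hφ.2.mul_left)
    unfold Zbar dZbar dRe dIm dT
    fun_prop
  simp only [dbarSmooth, wedgeSum, Finset.sum_apply, Pi.smul_apply, ← toDist_Zbar lam _ (hu _) hφ]
  simp only [toDist, Finset.sum_apply, Pi.smul_apply, Finset.sum_mul, smul_mul_assoc]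
  refine (integral_finsetSum _ fun k _ => (hi _ _).smul ((-1 : ℤ) ^ _)).trans ?_
  refine Finset.sum_congr rfl fun k _ => ?_
  simp only [Pi.smul_apply, zsmul_eq_mul]
  exact integral_const_mul _ _

/-- The graph of the weak operator `∂̄_b`. -/
def dbarGraph {n : ℕ} (lam : Fin n → ℝ) (q : ℕ) :
    Submodule ℂ (L2Form n q × L2Form n (q + 1)) where
  carrier := {p | IsWeakDbar lam p.1 p.2}
  add_mem' := by
    intro a b ha hb K φ hφ
    have ha' := ha K φ hφ
    have hb' := hb K φ hφ
    have hz := fun k => hφ.zbar lam k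
    simp only [wedgeSum, distZbar, toDist, Finset.sum_apply, Pi.smul_apply, Prod.fst_add,
      Prod.snd_add] at ha' hb' ⊢
    rw [integral_coeff_add _ _ _ hφ.1.continuous hφ.2, ← ha', ← hb', ← Finset.sum_add_distrib]
    refine Finset.sum_congr rfl fun k _ => ?_
    rw [integral_coeff_add _ _ _ (hz k.1).1 (hz k.1).2, neg_add, smul_add]
  zero_mem' := by
    intro K φ hφ
    have h0 : ∀ {r : ℕ} (J : MultiIndex n r) (ψ : H n → ℂ),
        ∫ x, coeff (0 : L2Form n r) J x * ψ x ∂vol n = 0 := fun J ψ => by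
      simpa using integral_coeff_smul 0 0 J ψ
    simp [wedgeSum, distZbar, toDist, h0]
  smul_mem' := by
    intro c a ha K φ hφ
    have ha' := ha K φ hφ
    simp only [wedgeSum, distZbar, toDist, Finset.sum_apply, Pi.smul_apply, Prod.smul_fst,
      Prod.smul_snd] at ha' ⊢
    rw [integral_coeff_smul, ← ha', Finset.mul_sum]
    refine Finset.sum_congr rfl fun k _ => ?_
    rw [integral_coeff_smul, mul_smul_comm, mul_neg]

/-- The distributional `∂̄_b u` is unique, so that `dbarGraph` is the graph of an operator. -/
lemma dbarGraph_unique {n : ℕ} (lam : Fin n → ℝ) (q : ℕ)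
    (p : L2Form n q × L2Form n (q + 1)) (hp : p ∈ dbarGraph lam q) (h0 : p.1 = 0) : p.2 = 0 := by
  have key : ∀ K, ∀ᵐ x ∂vol n, coeff p.2 K x = 0 := by
    intro K
    refine ae_eq_zero_of_integral_contDiff_smul_eq_zero
      ((memLp_coeff p.2 K).locallyIntegrable (by norm_num)) ?_
    intro g hg hgs
    have ht : IsTest (fun x => (g x : ℂ)) :=
      ⟨Complex.ofRealCLM.contDiff.comp hg, hgs.comp_left (g := Complex.ofReal) (by simp)⟩
    have h := hp K _ ht
    have h1 : ∀ (J : MultiIndex n q) (ψ : H n → ℂ),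
        ∫ x, coeff (0 : L2Form n q) J x * ψ x ∂vol n = 0 := fun J ψ => by
      simpa using integral_coeff_smul 0 0 J ψ
    rw [h0] at h
    simp only [wedgeSum, distZbar, toDist, Finset.sum_apply, Pi.smul_apply, h1] at h
    simp only [neg_zero, smul_zero, Finset.sum_const_zero] at h
    rw [h]
    refine integral_congr_ae (Filter.Eventually.of_forall fun x => ?_)
    simp [mul_comm]
  rw [Lp.eq_zero_iff_ae_eq_zero]
  filter_upwards [ae_all_iff.2 key] with x hx
  ext K
  exact hx K

/-- The maximal (weak) extension
`∂̄_b : Dom ∂̄_b ⊆ L²_{(0,q)}(H_{n+1}) → L²_{(0,q+1)}(H_{n+1})`: a form `u` lies in the domain iff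
its distributional `∂̄_b u` is in `L²_{(0,q+1)}`. -/
def dbar {n : ℕ} (lam : Fin n → ℝ) (q : ℕ) : L2Form n q →ₗ.[ℂ] L2Form n (q + 1) :=
  (dbarGraph lam q).toLinearPMap

/-- The Hilbert space adjoint of `∂̄_b`. -/
def dbarStar {n : ℕ} (lam : Fin n → ℝ) (q : ℕ) : L2Form n (q + 1) →ₗ.[ℂ] L2Form n q :=
  (dbar lam q).adjoint

/-- Composition `g ∘ f` of partially defined operators, with domain
`{x ∈ Dom f | f x ∈ Dom g}`. -/
def pcomp {E F G : Type*} [AddCommGroup E] [Module ℂ E] [AddCommGroup F] [Module ℂ F]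
    [AddCommGroup G] [Module ℂ G] (g : F →ₗ.[ℂ] G) (f : E →ₗ.[ℂ] F) : E →ₗ.[ℂ] G :=
  g.comp (f.domRestrict ((g.domain.comap f.toFun).map f.domain.subtype)) (by
    rintro ⟨x, hx⟩
    obtain ⟨y, hy, hxy⟩ := hx.1
    have : f.domRestrict _ ⟨x, hx⟩ = f y := LinearPMap.domRestrict_apply hxy.symm
    rw [this]
    exact hy)

/-- The Gaffney extension of the Kohn Laplacian, `□_b = ∂̄_b ∂̄_b^* + ∂̄_b^* ∂̄_b`. The sum of
partially defined operators is defined on the intersection of their domains. On functions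
(`q = 0`) the first summand is absent, there being no forms of degree `-1`. -/
def kohnLaplacian {n : ℕ} (lam : Fin n → ℝ) : (q : ℕ) → (L2Form n q →ₗ.[ℂ] L2Form n q)
  | 0 => pcomp (dbarStar lam 0) (dbar lam 0)
  | q + 1 => pcomp (dbar lam q) (dbarStar lam q) + pcomp (dbarStar lam (q + 1)) (dbar lam (q + 1))

/-- `ℋ^q_b(H_{n+1}) = Ker □_b^{(q)}`, as a subspace of `L²_{(0,q)}(H_{n+1})`. -/
def harmonicSpace {n : ℕ} (lam : Fin n → ℝ) (q : ℕ) : Submodule ℂ (L2Form n q) :=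
  (LinearMap.ker (kohnLaplacian lam q).toFun).map (kohnLaplacian lam q).domain.subtype

end Heisenberg

end

/-!
The coefficients of a harmonic form `u` decouple: since `∂̄_b u = 0` and `∂̄_b^* u = 0`, and since
fields with different indices commute, `u_J` is a weak solution of `∑ A_k^* A_k u_J = 0`, where
`A_k = Z_k` for `k ∈ J` and `A_k = conj Z_k` otherwise. These fields are left invariant, so left
convolution with a test function turns `u_J` into a smooth square integrable solution `f`, and the
energy identity, tested against dilated cut-offs, gives `A_k f = 0` for all `k`. The commutator of
`A_k` and `A_k^*` is a multiple `± λ_k` of `∂/∂t`, with the sign depending on whether `k ∈ J`. If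
two of these multiples have opposite signs, then a positive combination of the operators `A_k A_k^*`
also annihilates `f`, so `A_k^* f = 0` and therefore `∂f/∂t = 0`; if `λ_j = 0`, then the same
argument for the single index `j` gives `A_j^* f = 0` and `∂f/∂x_{2j-1} = 0`. In both cases the
square integrable function `f` is constant in one direction, hence zero. The excluded degrees `n_-`
and `n_+` are those in which the multiples can all have one sign.
-/

noncomputable section

open Filter Topology Function

lemma measure_eq_top_of_forall_add_smul_mem {E : Type*} [NormedAddCommGroup E] [NormedSpace ℝ E]
    [MeasurableSpace E] [BorelSpace E] {μ : Measure E} [μ.IsAddLeftInvariant]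
    [μ.IsOpenPosMeasure] {S : Set E} (hS : IsOpen S) (hne : S.Nonempty) {v : E} (hv : v ≠ 0)
    (hinv : ∀ x ∈ S, ∀ r : ℝ, x + r • v ∈ S) : μ S = ⊤ := by
  obtain ⟨x, hx⟩ := hne
  obtain ⟨ε, hε, hball⟩ := Metric.isOpen_iff.1 hS x hx
  have hv' : 0 < ‖v‖ := norm_pos_iff.2 hv
  let a : ℕ → E := fun m => (m * (2 * ε / ‖v‖)) • v
  have hdisj : Pairwise (Disjoint on fun m => Metric.ball (x + a m) ε) := by
    intro m l hml
    refine Metric.ball_disjoint_ball ?_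
    have hdist : (1 : ℝ) ≤ |(m : ℝ) - l| := by
      exact_mod_cast Int.one_le_abs (sub_ne_zero.2 (Nat.cast_injective.ne hml))
    rw [dist_add_left, dist_eq_norm, ← sub_smul, norm_smul, ← sub_mul, norm_mul, Real.norm_eq_abs,
      Real.norm_of_nonneg (by positivity), mul_assoc, div_mul_cancel₀ _ hv'.ne']
    nlinarith
  have hmeas : ∀ m, μ (Metric.ball (x + a m) ε) = μ (Metric.ball x ε) := fun m => by
    rw [← measure_preimage_add μ (a m), preimage_add_ball, add_sub_cancel_right]
  have hsub : ⋃ m, Metric.ball (x + a m) ε ⊆ S := by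
    refine Set.iUnion_subset fun m y hy => ?_
    have hy' : y - a m ∈ S := hball (by
      rw [Metric.mem_ball, dist_eq_norm] at hy ⊢
      rwa [sub_sub, add_comm (a m)])
    simpa only [a, sub_add_cancel] using hinv _ hy' (m * (2 * ε / ‖v‖))
  refine measure_mono_top hsub ?_
  rw [measure_iUnion hdisj fun _ => measurableSet_ball]
  simp only [hmeas]
  exact ENNReal.tsum_const_eq_top_of_ne_zero (Metric.measure_ball_pos μ x hε).ne'

lemma eq_zero_of_memLp_of_fderiv_eq_zero {E F : Type*} [NormedAddCommGroup E] [NormedSpace ℝ E]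
    [MeasurableSpace E] [BorelSpace E] [NormedAddCommGroup F] [NormedSpace ℝ F] {μ : Measure E}
    [μ.IsAddLeftInvariant] [μ.IsOpenPosMeasure] {p : ℝ≥0∞} (hp₀ : p ≠ 0) (hp : p ≠ ⊤)
    {f : E → F} (hf : Differentiable ℝ f) (hfp : MemLp f p μ) {v : E} (hv : v ≠ 0)
    (hfv : ∀ x, fderiv ℝ f x v = 0) : f = 0 := by
  have hconst : ∀ x (r : ℝ), f (x + r • v) = f x := by
    intro x r
    have hderiv : ∀ t : ℝ, HasDerivAt (fun t : ℝ => f (x + t • v)) 0 t := by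
      intro t
      rw [← hfv (x + t • v)]
      refine (hf _).hasFDerivAt.comp_hasDerivAt t ?_
      simpa using ((hasDerivAt_id t).smul_const v).const_add x
    simpa using is_const_of_deriv_eq_zero (fun t => (hderiv t).differentiableAt)
      (fun t => (hderiv t).deriv) r 0
  by_contra hne
  obtain ⟨x₀, hx₀⟩ := Function.ne_iff.1 hne
  have hpos : 0 < ‖f x₀‖₊ := nnnorm_pos.2 hx₀
  have htop : μ {x | ‖f x₀‖₊ / 2 < ‖f x‖₊} = ⊤ :=
    measure_eq_top_of_forall_add_smul_mem (isOpen_lt continuous_const hf.continuous.nnnorm)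
      ⟨x₀, NNReal.half_lt_self hpos.ne'⟩ hv fun x hx r => by
        simpa only [Set.mem_ofPred_eq, hconst] using hx
  refine (hfp.meas_ge_lt_top hp₀ hp (half_pos hpos).ne').ne (measure_mono_top ?_ htop)
  exact fun x hx => (Set.mem_ofPred_eq ▸ hx : _ < _).le

lemma eq_zero_of_tendsto_integral_norm_sq {X E : Type*} [TopologicalSpace X] [MeasurableSpace X]
    {μ : Measure X} [μ.IsOpenPosMeasure] [NormedAddCommGroup E] {f : ℕ → X → E} {g : X → E}
    (hg : Continuous g) (hf : ∀ m, MemLp (f m) 2 μ)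
    (hfg : ∀ x, Tendsto (fun m => f m x) atTop (𝓝 (g x)))
    (hlim : Tendsto (fun m => ∫ x, ‖f m x‖ ^ 2 ∂μ) atTop (𝓝 0)) : g = 0 := by
  have hnorm : ∀ m, eLpNorm (f m) 2 μ = ENNReal.ofReal ((∫ x, ‖f m x‖ ^ 2 ∂μ) ^ (2⁻¹ : ℝ)) := by
    intro m
    rw [(hf m).eLpNorm_eq_integral_rpow_norm (by simp) (by simp)]
    simp only [ENNReal.toReal_ofNat, Real.rpow_ofNat]
  have hzero : Tendsto (fun m => eLpNorm (f m) 2 μ) atTop (𝓝 0) := by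
    simp only [hnorm]
    have h := ENNReal.tendsto_ofReal (hlim.rpow_const (p := 2⁻¹) (Or.inr (by norm_num)))
    rwa [Real.zero_rpow (by norm_num), ENNReal.ofReal_zero] at h
  have hle := Lp.eLpNorm_lim_le_liminf_eLpNorm (p := 2) (fun m => (hf m).1) g (.of_forall hfg)
  rw [hzero.liminf_eq, nonpos_iff_eq_zero] at hle
  have hgm : AEStronglyMeasurable g μ :=
    aestronglyMeasurable_of_tendsto_ae atTop (fun m => (hf m).1) (.of_forall hfg)
  exact Measure.eq_of_ae_eq ((eLpNorm_eq_zero_iff hgm two_ne_zero).1 hle) hg continuous_const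

lemma lintegral_mul_sq_le {α : Type*} [MeasurableSpace α] {μ : Measure α} {a b : α → ℝ≥0∞}
    (ha : AEMeasurable a μ) (hb : AEMeasurable b μ) :
    (∫⁻ y, a y * b y ∂μ) ^ 2 ≤ (∫⁻ y, a y ^ 2 * b y ∂μ) * ∫⁻ y, b y ∂μ := by
  have hroot : ∀ c : ℝ≥0∞, (c ^ (2⁻¹ : ℝ)) ^ 2 = c := fun c => by
    rw [← ENNReal.rpow_ofNat, ← ENNReal.rpow_mul]
    norm_num
  have hab : ∀ y, a y * b y = (a y ^ 2 * b y) ^ (2⁻¹ : ℝ) * b y ^ (2⁻¹ : ℝ) := fun y => by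
    rw [← ENNReal.mul_rpow_of_nonneg _ _ (by norm_num),
      show a y ^ 2 * b y * b y = (a y * b y) ^ (2 : ℝ) by rw [ENNReal.rpow_ofNat]; ring,
      ← ENNReal.rpow_mul]
    norm_num
  have hCS := ENNReal.lintegral_mul_norm_pow_le ((ha.pow_const 2).mul hb) hb
    (p := 2⁻¹) (q := 2⁻¹) (by norm_num) (by norm_num) (by norm_num)
  simp only [Pi.mul_apply, ← hab] at hCS
  calc (∫⁻ y, a y * b y ∂μ) ^ 2
      ≤ ((∫⁻ y, a y ^ 2 * b y ∂μ) ^ (2⁻¹ : ℝ) * (∫⁻ y, b y ∂μ) ^ (2⁻¹ : ℝ)) ^ 2 := by gcongr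
    _ = _ := by rw [mul_pow, hroot, hroot]

section Kernel

variable {X Y 𝕜 : Type*} [RCLike 𝕜]

/-- Schur's test. -/
lemma memLp_two_integral_mul_kernel [MeasurableSpace X] [MeasurableSpace Y] {μ : Measure X}
    {ν : Measure Y} [SFinite μ] [SFinite ν] {K : X × Y → 𝕜} {w : Y → 𝕜} {C D : ℝ≥0∞}
    (hC : C ≠ ⊤) (hD : D ≠ ⊤) (hK : AEStronglyMeasurable K (μ.prod ν))
    (hrow : ∀ x, ∫⁻ y, ‖K (x, y)‖ₑ ∂ν ≤ C) (hcol : ∀ y, ∫⁻ x, ‖K (x, y)‖ₑ ∂μ ≤ D)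
    (hw : MemLp w 2 ν) : MemLp (fun x => ∫ y, w y * K (x, y) ∂ν) 2 μ := by
  have hKw : AEStronglyMeasurable (fun p : X × Y => w p.2 * K p) (μ.prod ν) :=
    hw.1.comp_snd.mul hK
  refine ⟨hKw.integral_prod_right', ?_⟩
  rw [eLpNorm_lt_top_iff_lintegral_rpow_enorm_lt_top two_ne_zero ENNReal.ofNat_ne_top]
  have hw₂ := (eLpNorm_lt_top_iff_lintegral_rpow_enorm_lt_top two_ne_zero ENNReal.ofNat_ne_top).1
    hw.2
  simp only [ENNReal.toReal_ofNat, ENNReal.rpow_ofNat] at hw₂ ⊢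
  have hpoint : ∀ᵐ x ∂μ, ‖∫ y, w y * K (x, y) ∂ν‖ₑ ^ 2 ≤
      (∫⁻ y, ‖w y‖ₑ ^ 2 * ‖K (x, y)‖ₑ ∂ν) * C := by
    filter_upwards [hK.prodMk_left] with x hx
    calc ‖∫ y, w y * K (x, y) ∂ν‖ₑ ^ 2 ≤ (∫⁻ y, ‖w y‖ₑ * ‖K (x, y)‖ₑ ∂ν) ^ 2 := by
          gcongr
          simpa only [enorm_mul] using enorm_integral_le_lintegral_enorm fun y => w y * K (x, y)
      _ ≤ _ := lintegral_mul_sq_le hw.1.enorm hx.enorm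
      _ ≤ _ := by gcongr; exact hrow x
  calc ∫⁻ x, ‖∫ y, w y * K (x, y) ∂ν‖ₑ ^ 2 ∂μ
      ≤ ∫⁻ x, (∫⁻ y, ‖w y‖ₑ ^ 2 * ‖K (x, y)‖ₑ ∂ν) * C ∂μ := lintegral_mono_ae hpoint
    _ = (∫⁻ y, ∫⁻ x, ‖w y‖ₑ ^ 2 * ‖K (x, y)‖ₑ ∂μ ∂ν) * C := by
        rw [lintegral_mul_const' _ _ hC, lintegral_lintegral_swap]
        exact (hw.1.comp_snd.enorm.pow_const 2).mul hK.enorm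
    _ ≤ (∫⁻ y, ‖w y‖ₑ ^ 2 * D ∂ν) * C := by
        gcongr with y
        rw [lintegral_const_mul' _ _ (by simp)]
        gcongr
        exact hcol y
    _ < ⊤ := by
        rw [lintegral_mul_const' _ _ hD]
        exact ENNReal.mul_lt_top (ENNReal.mul_lt_top hw₂ hD.lt_top) hC.lt_top

lemma integrable_mul_kernel [TopologicalSpace X] [T2Space X] [TopologicalSpace Y]
    [MeasurableSpace X] [OpensMeasurableSpace X] [MeasurableSpace Y] [T2Space Y]
    [OpensMeasurableSpace Y] [OpensMeasurableSpace (X × Y)] {μ : Measure X}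
    [IsFiniteMeasureOnCompacts μ] {ν : Measure Y} [SFinite ν] {w : Y → 𝕜}
    (hw : LocallyIntegrable w ν) {K : X × Y → 𝕜} (hK : Continuous K) (hKc : HasCompactSupport K) :
    Integrable (fun p : X × Y => w p.2 * K p) (μ.prod ν) := by
  have hA : IsCompact (Prod.fst '' tsupport K) := hKc.isCompact.image continuous_fst
  have hB : IsCompact (Prod.snd '' tsupport K) := hKc.isCompact.image continuous_snd
  obtain ⟨C, hC⟩ := hK.bounded_above_of_compact_support hKc
  have hone : Integrable ((Prod.fst '' tsupport K).indicator fun _ => (1 : 𝕜)) μ :=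
    (integrable_indicator_iff hA.measurableSet).2 (integrableOn_const hA.measure_lt_top.ne)
  have hwB : Integrable ((Prod.snd '' tsupport K).indicator w) ν :=
    (integrable_indicator_iff hB.measurableSet).2 (hw.integrableOn_isCompact hB)
  refine ((hone.mul_prod hwB).bdd_mul hK.aestronglyMeasurable (.of_forall hC)).congr
    (.of_forall fun p => ?_)
  by_cases hp : p ∈ tsupport K
  · simp only [Set.indicator_of_mem (Set.mem_image_of_mem _ hp), one_mul, mul_comm (K p)]
  · simp only [image_eq_zero_of_notMem_tsupport hp, zero_mul, mul_zero]

lemma contDiff_integral_mul_kernel [NormedAddCommGroup X] [NormedSpace ℝ X] [NormedAddCommGroup Y]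
    [NormedSpace ℝ Y] [MeasurableSpace Y] [BorelSpace Y] {ν : Measure Y} {w : Y → 𝕜}
    (hw : LocallyIntegrable w ν) {m : ℕ∞} {K : X × Y → 𝕜} (hK : ContDiff ℝ m K)
    (hKc : ∀ x₀, ∃ U ∈ 𝓝 x₀, ∃ B, IsCompact B ∧ ∀ x ∈ U, ∀ y ∉ B, K (x, y) = 0) :
    ContDiff ℝ m fun x => ∫ y, w y * K (x, y) ∂ν := by
  refine contDiff_iff_contDiffAt.2 fun x₀ => ?_
  obtain ⟨U, hU, B, hB, hKB⟩ := hKc x₀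
  obtain ⟨V, hVU, hV, hxV⟩ := mem_nhds_iff.1 hU
  have hconv := contDiffOn_convolution_right_with_param_comp (𝕜 := ℝ) (n := m) (μ := ν)
    (ContinuousLinearMap.mul ℝ 𝕜) (s := V) (v := fun _ => 0) (f := w)
    (g := fun x y => K (x, -y)) (k := -B) contDiffOn_const hV hB.neg
    (fun x y hx hy => hKB x (hVU hx) (-y) fun hyB => hy (Set.mem_neg.2 hyB)) hw
    (hK.comp (contDiff_fst.prodMk contDiff_snd.neg)).contDiffOn
  refine (hconv.contDiffAt (hV.mem_nhds hxV)).congr_of_eventuallyEq (.of_forall fun x => ?_)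
  simp only [convolution, zero_sub, neg_neg, ContinuousLinearMap.mul_apply']

end Kernel

namespace Heisenberg

open ComplexConjugate

variable {n : ℕ} {lam : Fin n → ℝ}

/-! ### Left invariant vector fields -/

/-- The real bilinear form `B(z, w) = 2 ∑ λ_k Im (conj z_k w_k)` for which the `Z_k` are left
invariant under the group law `(z, t) (w, s) = (z + w, t + s + B(z, w))`. -/
def twist (lam : Fin n → ℝ) : (Fin n → ℂ) →L[ℝ] (Fin n → ℂ) →L[ℝ] ℝ :=
  (LinearMap.mk₂ ℝ (fun z w => ∑ k, 2 * lam k * (conj (z k) * w k).im)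
    (fun z z' w => by simp [mul_add, add_mul, Finset.sum_add_distrib])
    (fun c z w => by
      simp only [Pi.smul_apply, Complex.real_smul, map_mul, Complex.conj_ofReal, mul_assoc,
        Complex.im_ofReal_mul, smul_eq_mul, Finset.mul_sum]
      exact Finset.sum_congr rfl fun k _ => by ring)
    (fun z w w' => by simp [mul_add, Finset.sum_add_distrib])
    (fun c z w => by
      simp only [Pi.smul_apply, Complex.real_smul, mul_left_comm _ (c : ℂ),
        Complex.im_ofReal_mul, smul_eq_mul, Finset.mul_sum]
      exact Finset.sum_congr rfl fun k _ => by ring)).toContinuousBilinearMap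

lemma twist_apply (z w : Fin n → ℂ) :
    twist lam z w = ∑ k, 2 * lam k * (conj (z k) * w k).im := by
  simp [twist]

lemma twist_single (z : Fin n → ℂ) (k : Fin n) (a : ℂ) :
    twist lam z (Pi.single k a) = 2 * lam k * (conj (z k) * a).im := by
  rw [twist_apply, Finset.sum_eq_single k (fun j _ hj => by simp [hj]) (by simp),
    Pi.single_eq_same]

lemma twist_swap (z w : Fin n → ℂ) : twist lam z w = -twist lam w z := by
  simp only [twist_apply, ← Finset.sum_neg_distrib]
  refine Finset.sum_congr rfl fun k _ => ?_
  simp only [Complex.mul_im, Complex.conj_re, Complex.conj_im]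
  ring

lemma twist_self (z : Fin n → ℂ) : twist lam z z = 0 :=
  self_eq_neg.1 (twist_swap z z)

/-- The left invariant vector field with value `(v, 0)` at the origin. -/
def leftField (lam : Fin n → ℝ) (v : Fin n → ℂ) (x : H n) : H n := (v, twist lam x.1 v)

lemma leftField_eq (v : Fin n → ℂ) (x : H n) :
    leftField lam v x = (v, 0) + twist lam x.1 v • (0, 1) := by
  simp [leftField]

lemma contDiff_leftField (v : Fin n → ℂ) {m : WithTop ℕ∞} : ContDiff ℝ m (leftField lam v) := by
  unfold leftField
  fun_prop

lemma hasFDerivAt_leftField (v : Fin n → ℂ) (x : H n) :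
    HasFDerivAt (leftField lam v)
      ((0 : H n →L[ℝ] Fin n → ℂ).prod
        (((twist lam).flip v).comp (ContinuousLinearMap.fst ℝ (Fin n → ℂ) ℝ))) x :=
  (hasFDerivAt_const v x).prodMk
    (((twist lam).flip v).comp (ContinuousLinearMap.fst ℝ (Fin n → ℂ) ℝ)).hasFDerivAt

/-- The derivative along a left invariant vector field. -/
def leftDeriv (lam : Fin n → ℝ) (v : Fin n → ℂ) (f : H n → ℂ) (x : H n) : ℂ :=
  fderiv ℝ f x (leftField lam v x)

lemma leftDeriv_eq (v : Fin n → ℂ) (f : H n → ℂ) (x : H n) :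
    leftDeriv lam v f x = fderiv ℝ f x (v, 0) + twist lam x.1 v * dT f x := by
  rw [leftDeriv, leftField_eq, map_add, map_smul, Complex.real_smul, dT]

lemma contDiff_leftDeriv (v : Fin n → ℂ) {f : H n → ℂ} {m k : WithTop ℕ∞} (hf : ContDiff ℝ k f)
    (hmk : m + 1 ≤ k) : ContDiff ℝ m (leftDeriv lam v f) :=
  (hf.fderiv_right hmk).clm_apply (contDiff_leftField v)

lemma leftDeriv_add (v : Fin n → ℂ) {f g : H n → ℂ} {x : H n} (hf : DifferentiableAt ℝ f x)
    (hg : DifferentiableAt ℝ g x) :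
    leftDeriv lam v (fun y => f y + g y) x = leftDeriv lam v f x + leftDeriv lam v g x := by
  rw [leftDeriv, fderiv_fun_add hf hg]
  rfl

lemma leftDeriv_const_mul (v : Fin n → ℂ) (c : ℂ) {f : H n → ℂ} {x : H n}
    (hf : DifferentiableAt ℝ f x) :
    leftDeriv lam v (fun y => c * f y) x = c * leftDeriv lam v f x := by
  rw [leftDeriv, fderiv_const_mul hf]
  rfl

lemma leftDeriv_mul (v : Fin n → ℂ) {f g : H n → ℂ} {x : H n} (hf : DifferentiableAt ℝ f x)
    (hg : DifferentiableAt ℝ g x) :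
    leftDeriv lam v (fun y => f y * g y) x =
      leftDeriv lam v f x * g x + f x * leftDeriv lam v g x := by
  rw [leftDeriv, fderiv_fun_mul hf hg]
  simp only [add_apply, smul_apply, smul_eq_mul, leftDeriv]
  ring

lemma leftDeriv_conj (v : Fin n → ℂ) {f : H n → ℂ} {x : H n} (hf : DifferentiableAt ℝ f x) :
    leftDeriv lam v (fun y => conj (f y)) x = conj (leftDeriv lam v f x) := by
  have h := Complex.conjCLE.toContinuousLinearMap.hasFDerivAt.comp x hf.hasFDerivAt
  exact congrArg (fun L => L (leftField lam v x)) h.fderiv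

lemma leftDeriv_leftDeriv (v w : Fin n → ℂ) {f : H n → ℂ} (hf : ContDiff ℝ 2 f) (x : H n) :
    leftDeriv lam v (leftDeriv lam w f) x =
      fderiv ℝ (fderiv ℝ f) x (leftField lam v x) (leftField lam w x) +
        twist lam v w * dT f x := by
  have hf' : DifferentiableAt ℝ (fderiv ℝ f) x :=
    (hf.fderiv_right (m := 1) (by norm_num)).differentiable one_ne_zero x
  have hvert : ((0 : Fin n → ℂ), twist lam v w) = twist lam v w • ((0 : Fin n → ℂ), (1 : ℝ)) := by
    simp
  have h := (hf'.hasFDerivAt.clm_apply (hasFDerivAt_leftField (lam := lam) w x)).fderiv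
  calc leftDeriv lam v (leftDeriv lam w f) x
      = fderiv ℝ (fun y => fderiv ℝ f y (leftField lam w y)) x (leftField lam v x) := rfl
    _ = fderiv ℝ f x (0, twist lam v w) +
          fderiv ℝ (fderiv ℝ f) x (leftField lam v x) (leftField lam w x) := by rw [h]; rfl
    _ = _ := by rw [hvert, map_smul, Complex.real_smul, dT, add_comm]

lemma leftDeriv_comm (v w : Fin n → ℂ) {f : H n → ℂ} (hf : ContDiff ℝ 2 f) (x : H n) :
    leftDeriv lam v (leftDeriv lam w f) x =
      leftDeriv lam w (leftDeriv lam v f) x + 2 * twist lam v w * dT f x := by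
  have hsymm : IsSymmSndFDerivAt ℝ f x := hf.contDiffAt.isSymmSndFDerivAt (by simp)
  rw [leftDeriv_leftDeriv v w hf, leftDeriv_leftDeriv w v hf, hsymm.eq, twist_swap w v]
  push_cast
  ring

/-- The complex left invariant field `(X_k + i s Y_k) / 2`, where `X_k`, `Y_k` extend
`∂/∂x_{2k-1}`, `∂/∂x_{2k}`: it is `conj Z_k` for `s = 1` and `Z_k` for `s = -1`. -/
def zField (lam : Fin n → ℝ) (s : ℝ) (k : Fin n) (f : H n → ℂ) (x : H n) : ℂ :=
  1 / 2 * (leftDeriv lam (Pi.single k 1) f x +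
    s * Complex.I * leftDeriv lam (Pi.single k Complex.I) f x)

lemma Zbar_eq_zField (k : Fin n) (f : H n → ℂ) : Zbar lam k f = zField lam 1 k f := by
  funext x
  rw [zField, leftDeriv_eq, leftDeriv_eq, twist_single, twist_single, Zbar, dZbar, dRe, dIm,
    ← Complex.re_add_im (x.1 k)]
  simp only [map_add, map_mul, Complex.conj_ofReal, Complex.conj_I, Complex.add_im, Complex.mul_im,
    Complex.add_re, Complex.mul_re, Complex.ofReal_re, Complex.ofReal_im, Complex.I_re,
    Complex.I_im, Complex.neg_re, Complex.neg_im, Complex.one_re, Complex.one_im]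
  push_cast
  linear_combination (lam k * (x.1 k).im * dT f x : ℂ) * Complex.I_sq

lemma contDiff_zField (s : ℝ) (k : Fin n) {f : H n → ℂ} {m l : WithTop ℕ∞} (hf : ContDiff ℝ l f)
    (hml : m + 1 ≤ l) : ContDiff ℝ m (zField lam s k f) :=
  contDiff_const.mul
    ((contDiff_leftDeriv _ hf hml).add (contDiff_const.mul (contDiff_leftDeriv _ hf hml)))

lemma zField_mul (s : ℝ) (k : Fin n) {f g : H n → ℂ} {x : H n} (hf : DifferentiableAt ℝ f x)
    (hg : DifferentiableAt ℝ g x) :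
    zField lam s k (fun y => f y * g y) x =
      zField lam s k f x * g x + f x * zField lam s k g x := by
  simp only [zField, leftDeriv_mul _ hf hg]
  ring

lemma zField_conj (s : ℝ) (k : Fin n) {f : H n → ℂ} {x : H n} (hf : DifferentiableAt ℝ f x) :
    zField lam s k (fun y => conj (f y)) x = conj (zField lam (-s) k f x) := by
  simp [zField, leftDeriv_conj _ hf, Complex.conj_ofNat]

lemma zField_zero (s : ℝ) (k : Fin n) : zField lam s k 0 = 0 := by
  funext x
  simp [zField, leftDeriv]

lemma leftDeriv_single_one_eq (s : ℝ) (k : Fin n) (f : H n → ℂ) (x : H n) :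
    leftDeriv lam (Pi.single k 1) f x = zField lam s k f x + zField lam (-s) k f x := by
  simp only [zField]
  push_cast
  ring

lemma leftDeriv_zField (v : Fin n → ℂ) (s : ℝ) (k : Fin n) {f : H n → ℂ} (hf : ContDiff ℝ 2 f)
    (x : H n) :
    leftDeriv lam v (zField lam s k f) x =
      1 / 2 * (leftDeriv lam v (leftDeriv lam (Pi.single k 1) f) x +
        s * Complex.I * leftDeriv lam v (leftDeriv lam (Pi.single k Complex.I) f) x) := by
  have hd : ∀ w, DifferentiableAt ℝ (leftDeriv lam w f) x := fun w =>
    (contDiff_leftDeriv w hf (m := 1) (by norm_num)).differentiable one_ne_zero x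
  rw [← leftDeriv_const_mul v _ (hd _), ← leftDeriv_add v (hd _) ((hd _).const_mul _)]
  exact leftDeriv_const_mul v _ ((hd _).fun_add ((hd _).const_mul _))

lemma zField_comm (s r : ℝ) (k l : Fin n) {f : H n → ℂ} (hf : ContDiff ℝ 2 f) (x : H n) :
    zField lam s k (zField lam r l f) x = zField lam r l (zField lam s k f) x +
      (if k = l then (r - s) * lam k * Complex.I else 0) * dT f x := by
  have hcomm : ∀ a b, leftDeriv lam (Pi.single k a) (leftDeriv lam (Pi.single l b) f) x =
      leftDeriv lam (Pi.single l b) (leftDeriv lam (Pi.single k a) f) x +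
        (if k = l then 4 * lam k * (conj a * b).im else 0) * dT f x := fun a b => by
    rw [leftDeriv_comm _ _ hf, twist_single]
    by_cases hkl : k = l
    · subst hkl
      simp only [Pi.single_eq_same, if_true]
      push_cast
      ring
    · simp [hkl]
  rw [zField.eq_1 lam s k (zField lam r l f), zField.eq_1 lam r l (zField lam s k f)]
  simp only [leftDeriv_zField _ _ _ hf, hcomm]
  split_ifs
  · simp only [map_one, one_mul, Complex.one_im, Complex.conj_I, neg_mul, Complex.I_mul_I, neg_neg,
      mul_one, Complex.I_im, Complex.neg_im]
    push_cast
    ring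
  · push_cast
    ring

lemma zField_comm_of_ne (s r : ℝ) {k l : Fin n} (hkl : k ≠ l) {f : H n → ℂ}
    (hf : ContDiff ℝ 2 f) :
    zField lam s k (zField lam r l f) = zField lam r l (zField lam s k f) := by
  funext x
  simpa [hkl] using zField_comm s r k l hf x

lemma zField_comm_neg (s : ℝ) (k : Fin n) {f : H n → ℂ} (hf : ContDiff ℝ 2 f) (x : H n) :
    zField lam (-s) k (zField lam s k f) x =
      zField lam s k (zField lam (-s) k f) x + 2 * (s * lam k : ℝ) * Complex.I * dT f x := by
  rw [zField_comm (-s) s k k hf, if_pos rfl]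
  push_cast
  ring

/-! ### Test functions and integration by parts -/

namespace IsTest

lemma contDiff {φ : H n → ℂ} (hφ : IsTest φ) {m : ℕ∞} : ContDiff ℝ m φ :=
  hφ.1.of_le (by exact_mod_cast le_top)

lemma differentiable {φ : H n → ℂ} (hφ : IsTest φ) : Differentiable ℝ φ :=
  hφ.1.differentiable (by simp)

lemma zero : IsTest (0 : H n → ℂ) :=
  ⟨contDiff_const, HasCompactSupport.zero⟩

lemma conjugate {φ : H n → ℂ} (hφ : IsTest φ) : IsTest fun x => conj (φ x) :=
  ⟨Complex.conjCLE.contDiff.comp hφ.1, hφ.2.comp_left (map_zero conj)⟩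

lemma mul_left {f φ : H n → ℂ} (hφ : IsTest φ) (hf : ContDiff ℝ ∞ f) :
    IsTest fun x => f x * φ x :=
  ⟨hf.mul hφ.1, hφ.2.mul_left⟩

lemma add {φ ψ : H n → ℂ} (hφ : IsTest φ) (hψ : IsTest ψ) : IsTest fun x => φ x + ψ x :=
  ⟨hφ.1.add hψ.1, hφ.2.add hψ.2⟩

lemma sum {ι : Type*} {I : Finset ι} {φ : ι → H n → ℂ} (hφ : ∀ i ∈ I, IsTest (φ i)) :
    IsTest fun x => ∑ i ∈ I, φ i x := by
  have h := Finset.sum_induction φ IsTest (fun _ _ => IsTest.add)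
    IsTest.zero hφ
  rwa [show (fun x => ∑ i ∈ I, φ i x) = ∑ i ∈ I, φ i from (Finset.sum_fn I φ).symm]

lemma leftDeriv (v : Fin n → ℂ) {φ : H n → ℂ} (hφ : IsTest φ) : IsTest (leftDeriv lam v φ) :=
  ⟨contDiff_leftDeriv v hφ.1 (by simp),
    (hφ.2.fderiv (𝕜 := ℝ)).mono fun x hx h => hx (by simp [Heisenberg.leftDeriv, h])⟩

lemma fderiv_apply (v : H n) {φ : H n → ℂ} (hφ : IsTest φ) : IsTest fun x => fderiv ℝ φ x v :=
  ⟨(hφ.1.fderiv_right (by simp)).clm_apply contDiff_const, hφ.2.fderiv_apply (𝕜 := ℝ) v⟩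

lemma dT {φ : H n → ℂ} (hφ : IsTest φ) : IsTest (dT φ) :=
  hφ.fderiv_apply (0, 1)

lemma zField (s : ℝ) (k : Fin n) {φ : H n → ℂ} (hφ : IsTest φ) : IsTest (zField lam s k φ) :=
  ((hφ.leftDeriv _).add ((hφ.leftDeriv _).mul_left contDiff_const)).mul_left contDiff_const

lemma memLp {φ : H n → ℂ} (hφ : IsTest φ) {p : ℝ≥0∞} : MemLp φ p (vol n) :=
  hφ.1.continuous.memLp_of_hasCompactSupport hφ.2

lemma integrable {φ : H n → ℂ} (hφ : IsTest φ) : Integrable φ (vol n) :=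
  memLp_one_iff_integrable.1 hφ.memLp

end IsTest

lemma integrable_mul_test {w φ : H n → ℂ}
    (hw : LocallyIntegrable w (vol n)) (hφ : IsTest φ) :
    Integrable (fun x => w x * φ x) (vol n) := by
  simpa only [smul_eq_mul, mul_comm] using
    hw.integrable_smul_left_of_hasCompactSupport hφ.1.continuous hφ.2

lemma ae_eq_zero_of_forall_integral_mul_test {w : H n → ℂ} (hw : LocallyIntegrable w (vol n))
    (h : ∀ φ, IsTest φ → ∫ x, w x * φ x ∂vol n = 0) : w =ᵐ[vol n] 0 := by
  refine ae_eq_zero_of_integral_contDiff_smul_eq_zero hw fun g hg hgc => ?_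
  have hφ : IsTest fun x => (g x : ℂ) :=
    ⟨Complex.ofRealCLM.contDiff.comp hg, hgc.comp_left Complex.ofReal_zero⟩
  simpa only [Complex.real_smul, mul_comm] using h _ hφ

lemma integral_mul_fderiv {f φ : H n → ℂ} (hf : ContDiff ℝ ∞ f) (hφ : IsTest φ) (v : H n) :
    ∫ x, f x * fderiv ℝ φ x v ∂vol n = -∫ x, fderiv ℝ f x v * φ x ∂vol n :=
  integral_mul_fderiv_eq_neg_fderiv_mul_of_integrable
    (hφ.mul_left ((hf.fderiv_right (by simp)).clm_apply contDiff_const)).integrable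
    ((hφ.fderiv_apply v).mul_left hf).integrable (hφ.mul_left hf).integrable
    (fun x _ => hf.differentiable (by simp) x) fun x _ => hφ.differentiable x

lemma integral_leftDeriv (v : Fin n → ℂ) {φ : H n → ℂ} (hφ : IsTest φ) :
    ∫ x, leftDeriv lam v φ x ∂vol n = 0 := by
  let τ : H n →L[ℝ] ℂ := Complex.ofRealCLM.comp
    (((twist lam).flip v).comp (ContinuousLinearMap.fst ℝ (Fin n → ℂ) ℝ))
  have hτ : ∫ x, τ x * dT φ x ∂vol n = 0 := by
    have hτ' : τ (0, 1) = 0 := by simp [τ]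
    simpa [dT, hτ'] using integral_mul_fderiv τ.contDiff hφ (0, 1)
  have hv : ∫ x, fderiv ℝ φ x (v, 0) ∂vol n = 0 := by
    simpa using integral_mul_fderiv (f := 1) contDiff_const hφ (v, 0)
  calc ∫ x, leftDeriv lam v φ x ∂vol n
      = ∫ x, (fderiv ℝ φ x (v, 0) + τ x * dT φ x) ∂vol n := by
        simp only [leftDeriv_eq]; rfl
    _ = 0 := by
      rw [integral_add (hφ.fderiv_apply _).integrable
        (hφ.dT.mul_left τ.contDiff).integrable, hv, hτ, add_zero]

lemma integral_zField_mul (s : ℝ) (k : Fin n) {f φ : H n → ℂ} (hf : ContDiff ℝ ∞ f)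
    (hφ : IsTest φ) :
    ∫ x, zField lam s k f x * φ x ∂vol n = -∫ x, f x * zField lam s k φ x ∂vol n := by
  have hfφ := hφ.mul_left hf
  have hdiv : ∫ x, zField lam s k (fun y => f y * φ y) x ∂vol n = 0 := by
    simp only [zField]
    rw [integral_const_mul, integral_add (hfφ.leftDeriv _).integrable
      ((hfφ.leftDeriv _).integrable.const_mul _), integral_const_mul, integral_leftDeriv _ hfφ,
      integral_leftDeriv _ hfφ, mul_zero, add_zero, mul_zero]
  simp only [zField_mul s k (hf.differentiable (by simp) _) (hφ.differentiable _)] at hdiv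
  rw [integral_add (hφ.mul_left (contDiff_zField s k hf (by simp))).integrable
    ((hφ.zField s k).mul_left hf).integrable] at hdiv
  exact eq_neg_of_add_eq_zero_left hdiv

/-! ### The group law and dilations -/

/-- The group law of the Heisenberg group, with inverse `x ↦ -x`. -/
def groupMul (lam : Fin n → ℝ) (x y : H n) : H n := (x.1 + y.1, x.2 + y.2 + twist lam x.1 y.1)

lemma contDiff_groupMul : ContDiff ℝ ∞ fun p : H n × H n => groupMul lam p.1 p.2 := by
  have : ContDiff ℝ ∞ fun p : H n × H n => twist lam p.1.1 p.2.1 :=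
    ((twist lam).contDiff.comp contDiff_fst.fst).clm_apply contDiff_snd.fst
  unfold groupMul
  fun_prop

@[fun_prop]
lemma continuous_groupMul {X : Type*} [TopologicalSpace X] {f g : X → H n} (hf : Continuous f)
    (hg : Continuous g) : Continuous fun x => groupMul lam (f x) (g x) :=
  contDiff_groupMul.continuous.comp (hf.prodMk hg)

lemma groupMul_groupMul_neg (x y : H n) : groupMul lam (groupMul lam x y) (-y) = x := by
  ext : 1
  · simp [groupMul]
  · simp only [groupMul, Prod.snd_neg, Prod.fst_neg, map_add, map_neg, add_apply, twist_self]
    ring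

lemma neg_groupMul_groupMul (x y : H n) : groupMul lam (-x) (groupMul lam x y) = y := by
  ext : 1
  · simp [groupMul]
  · simp only [groupMul, Prod.snd_neg, Prod.fst_neg, map_add, map_neg, neg_apply, twist_self]
    ring

lemma neg_groupMul_neg_groupMul (x y : H n) :
    groupMul lam (-groupMul lam x (-y)) x = y := by
  ext : 1
  · simp [groupMul]
  · simp only [groupMul, Prod.snd_neg, Prod.fst_neg, map_add, map_neg, neg_apply, add_apply,
      twist_self, twist_swap x.1 y.1]
    ring

lemma zero_groupMul (x : H n) : groupMul lam 0 x = x := by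
  simp [groupMul]

/-- Left translation by `g`. -/
def leftTranslation (lam : Fin n → ℝ) (g : H n) : H n ≃ₜ H n where
  toFun := groupMul lam g
  invFun := groupMul lam (-g)
  left_inv := neg_groupMul_groupMul g
  right_inv x := by simpa using neg_groupMul_groupMul (lam := lam) (-g) x

/-- Right translation by `g`. -/
def rightTranslation (lam : Fin n → ℝ) (g : H n) : H n ≃ₜ H n where
  toFun x := groupMul lam x g
  invFun x := groupMul lam x (-g)
  left_inv x := groupMul_groupMul_neg x g
  right_inv x := by simpa using groupMul_groupMul_neg (lam := lam) x (-g)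

lemma measurePreserving_shear (a : Fin n → ℂ) {b : (Fin n → ℂ) → ℝ} (hb : Continuous b) :
    MeasurePreserving (fun x : H n => (x.1 + a, x.2 + b x.1)) (vol n) (vol n) := by
  have h : MeasurePreserving (fun x : H n => (x.1 + a, x.2 + b x.1)) volume volume :=
    MeasurePreserving.skew_product (f := fun z : Fin n → ℂ => z + a) (g := fun z t => t + b z)
      (measurePreserving_add_right volume a)
      (by fun_prop : Continuous fun p : (Fin n → ℂ) × ℝ => p.2 + b p.1).measurable
      (.of_forall fun z => (measurePreserving_add_right volume (b z)).map_eq)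
  exact h.smul_measure ((2 : ℝ≥0∞) ^ n)

lemma measurePreserving_rightTranslation (g : H n) :
    MeasurePreserving (rightTranslation lam g) (vol n) (vol n) := by
  convert measurePreserving_shear g.1 (b := fun z => g.2 + twist lam z g.1) (by fun_prop) using 2
  simp [rightTranslation, groupMul, add_assoc]

lemma measurePreserving_leftTranslation (g : H n) :
    MeasurePreserving (leftTranslation lam g) (vol n) (vol n) := by
  convert measurePreserving_shear g.1 (b := fun z => g.2 + twist lam g.1 z) (by fun_prop) using 2
  simp [leftTranslation, groupMul, add_comm, add_left_comm, add_assoc]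

lemma hasFDerivAt_groupMul_left (g x : H n) :
    HasFDerivAt (groupMul lam g)
      ((ContinuousLinearMap.fst ℝ (Fin n → ℂ) ℝ).prod
        (ContinuousLinearMap.snd ℝ (Fin n → ℂ) ℝ +
          (twist lam g.1).comp (ContinuousLinearMap.fst ℝ (Fin n → ℂ) ℝ))) x :=
  (hasFDerivAt_fst.const_add _).prodMk
    ((hasFDerivAt_snd.const_add _).add
      ((twist lam g.1).comp (ContinuousLinearMap.fst ℝ (Fin n → ℂ) ℝ)).hasFDerivAt)

lemma leftDeriv_comp_groupMul (v : Fin n → ℂ) {f : H n → ℂ} (hf : Differentiable ℝ f)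
    (g x : H n) :
    leftDeriv lam v (fun y => f (groupMul lam g y)) x = leftDeriv lam v f (groupMul lam g x) := by
  have h := ((hf (groupMul lam g x)).hasFDerivAt.comp x (hasFDerivAt_groupMul_left g x)).fderiv
  calc leftDeriv lam v (fun y => f (groupMul lam g y)) x
      = fderiv ℝ (f ∘ groupMul lam g) x (leftField lam v x) := rfl
    _ = _ := by
      rw [h]
      simp [leftDeriv, leftField, groupMul, add_comm]

lemma zField_comp_groupMul (s : ℝ) (k : Fin n) {f : H n → ℂ} (hf : Differentiable ℝ f) (g : H n) :
    zField lam s k (fun y => f (groupMul lam g y)) =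
      fun x => zField lam s k f (groupMul lam g x) := by
  funext x
  simp only [zField, leftDeriv_comp_groupMul _ hf]

lemma IsTest.comp_groupMul {φ : H n → ℂ} (hφ : IsTest φ) (g : H n) :
    IsTest fun y => φ (groupMul lam g y) :=
  ⟨hφ.1.comp (contDiff_groupMul.comp (contDiff_const.prodMk contDiff_id)),
    hφ.2.comp_homeomorph (leftTranslation lam g)⟩

/-- The automorphism `(z, t) ↦ (r z, r² t)` of the Heisenberg group. -/
def dilation (n : ℕ) (r : ℝ) : H n →L[ℝ] H n :=
  (r • ContinuousLinearMap.fst ℝ (Fin n → ℂ) ℝ).prod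
    (r ^ 2 • ContinuousLinearMap.snd ℝ (Fin n → ℂ) ℝ)

lemma dilation_apply (r : ℝ) (x : H n) : dilation n r x = (r • x.1, r ^ 2 * x.2) := rfl

lemma dilation_injective {r : ℝ} (hr : r ≠ 0) : Injective (dilation n r) := fun x y hxy => by
  simp only [dilation_apply, Prod.mk.injEq] at hxy
  exact Prod.ext (smul_right_injective _ hr hxy.1) (mul_left_cancel₀ (pow_ne_zero 2 hr) hxy.2)

lemma leftDeriv_comp_dilation (v : Fin n → ℂ) {f : H n → ℂ} (hf : Differentiable ℝ f) (r : ℝ)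
    (x : H n) :
    leftDeriv lam v (fun y => f (dilation n r y)) x = r * leftDeriv lam v f (dilation n r x) := by
  have hfield : dilation n r (leftField lam v x) = r • leftField lam v (dilation n r x) := by
    simp [dilation, leftField, pow_two, mul_assoc]
  have h := ((hf (dilation n r x)).hasFDerivAt.comp x (dilation n r).hasFDerivAt).fderiv
  calc leftDeriv lam v (fun y => f (dilation n r y)) x
      = fderiv ℝ (f ∘ dilation n r) x (leftField lam v x) := rfl
    _ = _ := by
      rw [h, ContinuousLinearMap.comp_apply, hfield, map_smul, Complex.real_smul, leftDeriv]

lemma zField_comp_dilation (s : ℝ) (k : Fin n) {f : H n → ℂ} (hf : Differentiable ℝ f) (r : ℝ)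
    (x : H n) :
    zField lam s k (fun y => f (dilation n r y)) x = r * zField lam s k f (dilation n r x) := by
  simp only [zField, leftDeriv_comp_dilation _ hf]
  ring

/-- Cut-off functions, equal to `1` on balls that exhaust the group as `m → ∞`. -/
def cutoff (n m : ℕ) (x : H n) : ℂ :=
  ((default : ContDiffBump (0 : H n)) (dilation n (m + 1 : ℝ)⁻¹ x) : ℂ)

lemma isTest_cutoff_bump : IsTest fun x : H n => ((default : ContDiffBump (0 : H n)) x : ℂ) :=
  ⟨Complex.ofRealCLM.contDiff.comp (ContDiffBump.contDiff _),
    (ContDiffBump.hasCompactSupport _).comp_left Complex.ofReal_zero⟩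

lemma isTest_cutoff (n m : ℕ) : IsTest (cutoff n m) :=
  ⟨isTest_cutoff_bump.1.comp (dilation n _).contDiff,
    isTest_cutoff_bump.2.comp_isClosedEmbedding <|
      LinearMap.isClosedEmbedding_of_injective (f := (dilation n (m + 1 : ℝ)⁻¹).toLinearMap) <|
        LinearMap.ker_eq_bot.2 (dilation_injective (by positivity))⟩

lemma conj_cutoff (m : ℕ) (x : H n) : conj (cutoff n m x) = cutoff n m x :=
  Complex.conj_ofReal _

lemma eventually_cutoff_eq_one (x : H n) : ∀ᶠ m in atTop, cutoff n m x = 1 := by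
  have hinv : Tendsto (fun m : ℕ => (m + 1 : ℝ)⁻¹) atTop (𝓝 0) := by
    simpa using tendsto_one_div_add_atTop_nhds_zero_nat (𝕜 := ℝ)
  have hx : Tendsto (fun m : ℕ => dilation n (m + 1 : ℝ)⁻¹ x) atTop (𝓝 0) := by
    simpa [dilation_apply, ← Prod.mk_zero_zero] using
      (hinv.smul_const x.1).prodMk_nhds ((hinv.pow 2).mul_const x.2)
  filter_upwards [hx.eventually (ContDiffBump.eventuallyEq_one default)] with m hm
  rw [cutoff, hm, Pi.one_apply, Complex.ofReal_one]

lemma exists_norm_zField_cutoff_le (lam : Fin n → ℝ) (s : ℝ) (k : Fin n) :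
    ∃ C, ∀ m x, ‖zField lam s k (cutoff n m) x‖ ≤ C / (m + 1) := by
  have hbump := isTest_cutoff_bump.zField (lam := lam) s k
  obtain ⟨C, hC⟩ := hbump.1.continuous.bounded_above_of_compact_support hbump.2
  refine ⟨C, fun m x => ?_⟩
  set r : ℝ := (m + 1 : ℝ)⁻¹
  have hscale : zField lam s k (cutoff n m) x = r * zField lam s k _ (dilation n r x) :=
    zField_comp_dilation s k isTest_cutoff_bump.differentiable r x
  rw [hscale, norm_mul, Complex.norm_real, Real.norm_of_nonneg (by positivity), div_eq_inv_mul]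
  gcongr
  exact hC _

/-! ### Weak solutions of `∑ c_k A_k^* A_k w = 0` -/

/-- The operator `∑ c_k A_k (-A_k^*)`, where `A_k = (X_k + i s_k Y_k) / 2` and `-A_k^*` is its
complex conjugate `(X_k - i s_k Y_k) / 2`. Its transpose is `-∑ c_k A_k^* A_k`. -/
def weightedBox (lam c s : Fin n → ℝ) (φ : H n → ℂ) (x : H n) : ℂ :=
  ∑ k, c k * zField lam (s k) k (zField lam (-s k) k φ) x

/-- The equation `∑ c_k A_k^* A_k w = 0` in the sense of distributions. -/
def IsWeaklyHarmonic (lam c s : Fin n → ℝ) (w : H n → ℂ) : Prop :=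
  ∀ φ, IsTest φ → ∫ x, w x * weightedBox lam c s φ x ∂vol n = 0

section WeaklyHarmonic

variable {c s : Fin n → ℝ}

lemma IsTest.weightedBox {φ : H n → ℂ} (hφ : IsTest φ) : IsTest (weightedBox lam c s φ) :=
  .sum fun _ _ => ((hφ.zField _ _).zField _ _).mul_left contDiff_const

lemma weightedBox_comp_groupMul {φ : H n → ℂ} (hφ : IsTest φ) (g : H n) :
    weightedBox lam c s (fun y => φ (groupMul lam g y)) =
      fun x => weightedBox lam c s φ (groupMul lam g x) := by
  funext x
  simp only [weightedBox, zField_comp_groupMul _ _ hφ.differentiable,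
    zField_comp_groupMul _ _ (hφ.zField _ _).differentiable]

lemma integral_mul_weightedBox {w φ : H n → ℂ} (hw : LocallyIntegrable w (vol n))
    (hφ : IsTest φ) :
    ∫ x, w x * weightedBox lam c s φ x ∂vol n =
      ∑ k, c k * ∫ x, w x * zField lam (s k) k (zField lam (-s k) k φ) x ∂vol n := by
  simp only [weightedBox, Finset.mul_sum, mul_left_comm (w _)]
  rw [integral_finsetSum _ fun k _ =>
    (integrable_mul_test hw ((hφ.zField _ k).zField _ k)).const_mul _]
  simp only [integral_const_mul]

lemma energy_density_le (s : ℝ) (k : Fin n) {f χ : H n → ℂ} (hf : Differentiable ℝ f)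
    (hχ : Differentiable ℝ χ) (hreal : ∀ x, conj (χ x) = χ x) (x : H n) :
    1 / 2 * ‖χ x * zField lam s k f x‖ ^ 2 - 2 * ‖f x * zField lam (-s) k χ x‖ ^ 2 ≤
      (zField lam s k f x * zField lam (-s) k (fun y => conj (f y) * (χ y * χ y)) x).re := by
  have hf' : DifferentiableAt ℝ (fun y => conj (f y)) x :=
    Complex.conjCLE.differentiableAt.comp x (hf x)
  set a := χ x * zField lam s k f x with ha
  set b := conj (f x) * zField lam (-s) k χ x with hb
  have hexpand : zField lam s k f x * zField lam (-s) k (fun y => conj (f y) * (χ y * χ y)) x =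
      a * conj a + 2 * (a * b) := by
    rw [zField_mul (-s) k hf' ((hχ x).fun_mul (hχ x)), zField_mul (-s) k (hχ x) (hχ x),
      zField_conj (-s) k (hf x), neg_neg, ha, hb, map_mul, hreal]
    ring
  have hnorm : ‖f x * zField lam (-s) k χ x‖ = ‖b‖ := by
    simp only [hb, norm_mul, RCLike.norm_conj]
  have hab : -(‖a‖ * ‖b‖) ≤ (a * b).re := by
    rw [← norm_mul]
    exact (abs_le.1 (Complex.abs_re_le_norm _)).1
  have hre : (a * conj a + 2 * (a * b)).re = ‖a‖ ^ 2 + 2 * (a * b).re := by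
    rw [Complex.mul_conj, Complex.normSq_eq_norm_sq, Complex.add_re, Complex.ofReal_re]
    simp
  rw [hexpand, hre, hnorm]
  nlinarith only [hab, sq_nonneg (‖a‖ - 2 * ‖b‖)]

lemma energy_le (s : ℝ) (k : Fin n) {f χ : H n → ℂ} (hf : ContDiff ℝ ∞ f) (hχ : IsTest χ)
    (hreal : ∀ x, conj (χ x) = χ x) :
    1 / 2 * ∫ x, ‖χ x * zField lam s k f x‖ ^ 2 ∂vol n -
        2 * ∫ x, ‖f x * zField lam (-s) k χ x‖ ^ 2 ∂vol n ≤
      -(∫ x, f x * zField lam s k (zField lam (-s) k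
        (fun y => conj (f y) * (χ y * χ y))) x ∂vol n).re := by
  have hAf : ContDiff ℝ ∞ (zField lam s k f) := contDiff_zField s k hf (by simp)
  have hφ : IsTest fun y => conj (f y) * (χ y * χ y) :=
    (hχ.mul_left hχ.1).mul_left (Complex.conjCLE.contDiff.comp hf)
  have hint : Integrable (fun x => ‖χ x * zField lam s k f x‖ ^ 2) (vol n) := by
    simpa only [mul_comm] using (hχ.mul_left hAf).memLp.norm.integrable_sq
  have hint' : Integrable (fun x => ‖f x * zField lam (-s) k χ x‖ ^ 2) (vol n) :=
    ((hχ.zField (-s) k).mul_left hf).memLp.norm.integrable_sq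
  have hintφ := ((hφ.zField (lam := lam) (-s) k).mul_left hAf).integrable
  calc _ = ∫ x, (1 / 2 * ‖χ x * zField lam s k f x‖ ^ 2 -
          2 * ‖f x * zField lam (-s) k χ x‖ ^ 2) ∂vol n := by
        rw [integral_sub (hint.const_mul _) (hint'.const_mul _), integral_const_mul,
          integral_const_mul]
    _ ≤ ∫ x, (zField lam s k f x *
          zField lam (-s) k (fun y => conj (f y) * (χ y * χ y)) x).re ∂vol n :=
        integral_mono ((hint.const_mul _).sub (hint'.const_mul _)) hintφ.re
          (energy_density_le s k (hf.differentiable (by simp)) hχ.differentiable hreal)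
    _ = _ := by
        rw [← Complex.neg_re, ← integral_zField_mul s k hf (hφ.zField (-s) k)]
        exact integral_re hintφ

lemma IsWeaklyHarmonic.sum_integral_le (hc : 0 ≤ c) {f χ : H n → ℂ}
    (hharm : IsWeaklyHarmonic lam c s f) (hf : ContDiff ℝ ∞ f) (hχ : IsTest χ)
    (hreal : ∀ x, conj (χ x) = χ x) :
    ∑ k, c k * ∫ x, ‖χ x * zField lam (s k) k f x‖ ^ 2 ∂vol n ≤
      4 * ∑ k, c k * ∫ x, ‖f x * zField lam (-s k) k χ x‖ ^ 2 ∂vol n := by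
  have hφ : IsTest fun y => conj (f y) * (χ y * χ y) :=
    (hχ.mul_left hχ.1).mul_left (Complex.conjCLE.contDiff.comp hf)
  have hweak := congrArg Complex.re (hharm _ hφ)
  rw [integral_mul_weightedBox hf.continuous.locallyIntegrable hφ, Complex.re_sum] at hweak
  simp only [Complex.re_ofReal_mul, Complex.zero_re] at hweak
  have hsum := Finset.sum_le_sum fun k (_ : k ∈ Finset.univ) =>
    mul_le_mul_of_nonneg_left (energy_le (lam := lam) (s k) k hf hχ hreal) (hc k)
  simp only [mul_neg, Finset.sum_neg_distrib, hweak, mul_sub, Finset.sum_sub_distrib,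
    mul_left_comm (c _), ← Finset.mul_sum] at hsum
  linarith only [hsum]

lemma tendsto_integral_norm_sq_mul_zField_cutoff (s : ℝ) (k : Fin n) {f : H n → ℂ}
    (hf : MemLp f 2 (vol n)) :
    Tendsto (fun m => ∫ x, ‖f x * zField lam s k (cutoff n m) x‖ ^ 2 ∂vol n) atTop (𝓝 0) := by
  obtain ⟨C, hC⟩ := exists_norm_zField_cutoff_le lam s k
  have hbound : ∀ m : ℕ, ∫ x, ‖f x * zField lam s k (cutoff n m) x‖ ^ 2 ∂vol n ≤
      (C / (m + 1)) ^ 2 * ∫ x, ‖f x‖ ^ 2 ∂vol n := fun m => by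
    rw [← integral_const_mul]
    refine integral_mono_of_nonneg (.of_forall fun x => by positivity)
      (hf.norm.integrable_sq.const_mul _) (.of_forall fun x => ?_)
    dsimp only
    rw [norm_mul, mul_pow, mul_comm]
    gcongr
    exact hC m x
  have hzero : Tendsto (fun m : ℕ => (C / (m + 1 : ℝ)) ^ 2 * ∫ x, ‖f x‖ ^ 2 ∂vol n)
      atTop (𝓝 0) := by
    simpa [div_eq_mul_one_div C] using
      ((tendsto_one_div_add_atTop_nhds_zero_nat (𝕜 := ℝ)).const_mul C).pow 2 |>.mul_const
        (∫ x, ‖f x‖ ^ 2 ∂vol n)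
  exact squeeze_zero (fun m => integral_nonneg fun x => by positivity) hbound hzero

theorem IsWeaklyHarmonic.zField_eq_zero (hc : 0 ≤ c) {f : H n → ℂ}
    (hharm : IsWeaklyHarmonic lam c s f) (hf : ContDiff ℝ ∞ f) (hf₂ : MemLp f 2 (vol n))
    {k : Fin n} (hk : 0 < c k) : zField lam (s k) k f = 0 := by
  have hAf : ContDiff ℝ ∞ (zField lam (s k) k f) := contDiff_zField (s k) k hf (by simp)
  have hle : ∀ m, ∫ x, ‖cutoff n m x * zField lam (s k) k f x‖ ^ 2 ∂vol n ≤
      (c k)⁻¹ * (4 * ∑ l, c l * ∫ x, ‖f x * zField lam (-s l) l (cutoff n m) x‖ ^ 2 ∂vol n) :=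
    fun m => by
      rw [le_inv_mul_iff₀ hk]
      exact (Finset.single_le_sum (fun l _ => mul_nonneg (hc l) (integral_nonneg fun x =>
          by positivity)) (Finset.mem_univ k)).trans
        (hharm.sum_integral_le hc hf (isTest_cutoff n m) (conj_cutoff m))
  have hlim := ((tendsto_finsetSum Finset.univ fun l _ =>
    (tendsto_integral_norm_sq_mul_zField_cutoff (lam := lam) (-s l) l hf₂).const_mul
      (c l)).const_mul 4).const_mul (c k)⁻¹
  simp only [mul_zero, Finset.sum_const_zero] at hlim
  refine eq_zero_of_tendsto_integral_norm_sq (μ := vol n)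
    (f := fun m x => cutoff n m x * zField lam (s k) k f x)
    hAf.continuous (fun m => ?_) (fun x => ?_)
    (squeeze_zero (fun m => integral_nonneg fun x => by positivity) hle hlim)
  · simpa only [mul_comm] using ((isTest_cutoff n m).mul_left hAf).memLp
  · refine tendsto_const_nhds.congr' ?_
    filter_upwards [eventually_cutoff_eq_one x] with m hm
    rw [hm, one_mul]

lemma integral_mul_zField_neg_comm (s : ℝ) (k : Fin n) {f φ : H n → ℂ} (hf : ContDiff ℝ ∞ f)
    (h : zField lam s k f = 0) (hφ : IsTest φ) :
    ∫ x, f x * zField lam (-s) k (zField lam s k φ) x ∂vol n =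
      2 * (s * lam k : ℝ) * Complex.I * ∫ x, f x * dT φ x ∂vol n := by
  have hzero : ∫ x, f x * zField lam s k (zField lam (-s) k φ) x ∂vol n = 0 := by
    simpa [h] using
      (integral_zField_mul (lam := lam) s k hf (hφ.zField (lam := lam) (-s) k)).symm
  simp only [zField_comm_neg s k hφ.contDiff, mul_add, mul_left_comm (f _)]
  rw [integral_add (((hφ.zField (-s) k).zField s k).mul_left hf).integrable
    ((hφ.dT.mul_left hf).integrable.const_mul _), hzero, integral_const_mul, zero_add]

lemma isWeaklyHarmonic_neg {f : H n → ℂ} (hf : ContDiff ℝ ∞ f)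
    (h : ∀ k, zField lam (s k) k f = 0) (hbal : ∑ k, c k * (s k * lam k) = 0) :
    IsWeaklyHarmonic lam c (-s) f := fun φ hφ => by
  have hbal' : ∑ k, (c k : ℂ) * (s k * lam k : ℝ) = 0 := by exact_mod_cast hbal
  rw [integral_mul_weightedBox hf.continuous.locallyIntegrable hφ]
  simp only [Pi.neg_apply, neg_neg, integral_mul_zField_neg_comm _ _ hf (h _) hφ]
  calc _ = (∑ k, (c k : ℂ) * (s k * lam k : ℝ)) *
        (2 * Complex.I * ∫ x, f x * dT φ x ∂vol n) := by
        rw [Finset.sum_mul]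
        exact Finset.sum_congr rfl fun k _ => by ring
    _ = 0 := by rw [hbal', zero_mul]

lemma zField_neg_eq_zero (hc : 0 ≤ c) {f : H n → ℂ} (hf : ContDiff ℝ ∞ f)
    (hf₂ : MemLp f 2 (vol n)) (h : ∀ k, zField lam (s k) k f = 0)
    (hbal : ∑ k, c k * (s k * lam k) = 0) {k : Fin n} (hk : 0 < c k) :
    zField lam (-s k) k f = 0 :=
  (isWeaklyHarmonic_neg hf h hbal).zField_eq_zero hc hf hf₂ hk

lemma eq_zero_of_forall_zField_eq_zero_of_lam_eq_zero {f : H n → ℂ} (hf : ContDiff ℝ ∞ f)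
    (hf₂ : MemLp f 2 (vol n)) (h : ∀ k, zField lam (s k) k f = 0) {j : Fin n} (hj : lam j = 0) :
    f = 0 := by
  have hbar : zField lam (-s j) j f = 0 :=
    zField_neg_eq_zero (c := Pi.single j 1) (Pi.single_nonneg.2 zero_le_one) hf hf₂ h
      (by simp [Pi.single_apply, hj]) (by simp)
  refine eq_zero_of_memLp_of_fderiv_eq_zero two_ne_zero (by simp) (hf.differentiable (by simp)) hf₂
    (v := (Pi.single j 1, 0)) (by simp) fun x => ?_
  simpa [h j, hbar, leftDeriv_eq, twist_single, hj] using
    leftDeriv_single_one_eq (lam := lam) (s j) j f x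

lemma eq_zero_of_forall_zField_eq_zero_of_opposite_signs {f : H n → ℂ} (hf : ContDiff ℝ ∞ f)
    (hf₂ : MemLp f 2 (vol n)) (h : ∀ k, zField lam (s k) k f = 0) {k l : Fin n}
    (hk : 0 < s k * lam k) (hl : s l * lam l < 0) : f = 0 := by
  have hkl : k ≠ l := by
    rintro rfl
    exact lt_asymm hk hl
  have hbar : zField lam (-s k) k f = 0 := by
    refine zField_neg_eq_zero (c := Pi.single k (-(s l * lam l)) + Pi.single l (s k * lam k))
      (add_nonneg (Pi.single_nonneg.2 (neg_pos.2 hl).le) (Pi.single_nonneg.2 hk.le)) hf hf₂ h ?_ ?_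
    · simp only [Pi.add_apply, Pi.single_apply, add_mul, ite_mul, zero_mul,
        Finset.sum_add_distrib, Finset.sum_ite_eq', Finset.mem_univ, if_true]
      ring
    · simpa [hkl] using hl
  refine eq_zero_of_memLp_of_fderiv_eq_zero two_ne_zero (by simp) (hf.differentiable (by simp)) hf₂
    (v := (0, 1)) (by simp) fun x => ?_
  have hcomm := zField_comm_neg (lam := lam) (s k) k (contDiff_infty.1 hf 2) x
  rw [h k, hbar, zField_zero, zField_zero, Pi.zero_apply, zero_add, eq_comm] at hcomm
  exact (mul_eq_zero.1 hcomm).resolve_left (mul_ne_zero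
    (mul_ne_zero two_ne_zero (Complex.ofReal_ne_zero.2 hk.ne')) Complex.I_ne_zero)

end WeaklyHarmonic

/-! ### Regularisation by convolution -/

/-- The group convolution `ψ * w`, with kernel `ψ(x y⁻¹)`. It commutes with the left invariant
fields acting on `w`. -/
def groupConv (lam : Fin n → ℝ) (ψ w : H n → ℂ) (x : H n) : ℂ :=
  ∫ y, w y * ψ (groupMul lam x (-y)) ∂vol n

lemma contDiff_groupConv {ψ w : H n → ℂ} (hψ : IsTest ψ) (hw : LocallyIntegrable w (vol n)) :
    ContDiff ℝ ∞ (groupConv lam ψ w) := by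
  refine contDiff_integral_mul_kernel hw (m := ⊤)
    (K := fun p : H n × H n => ψ (groupMul lam p.1 (-p.2)))
    (hψ.1.comp (contDiff_groupMul.comp (contDiff_fst.prodMk contDiff_snd.neg))) fun x₀ => ?_
  refine ⟨Metric.closedBall x₀ 1, Metric.closedBall_mem_nhds x₀ one_pos,
    (fun p : H n × H n => groupMul lam (-p.2) p.1) '' Metric.closedBall x₀ 1 ×ˢ tsupport ψ,
    ((isCompact_closedBall x₀ 1).prod hψ.2).image (by fun_prop), fun x hx y hy => ?_⟩
  exact image_eq_zero_of_notMem_tsupport (f := ψ) fun hmem =>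
    hy ⟨(x, groupMul lam x (-y)), ⟨hx, hmem⟩, neg_groupMul_neg_groupMul x y⟩

lemma memLp_groupConv {ψ w : H n → ℂ} (hψ : IsTest ψ) (hw : MemLp w 2 (vol n)) :
    MemLp (groupConv lam ψ w) 2 (vol n) := by
  have hψ_meas : Measurable fun y => ‖ψ y‖ₑ := hψ.1.continuous.enorm.measurable
  have hψ_fin : ∫⁻ y, ‖ψ y‖ₑ ∂vol n ≠ ⊤ := hψ.integrable.2.ne
  have hcont : Continuous fun p : H n × H n => ψ (groupMul lam p.1 (-p.2)) :=
    hψ.1.continuous.comp (by fun_prop)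
  refine memLp_two_integral_mul_kernel hψ_fin hψ_fin hcont.aestronglyMeasurable
    (fun x => ?_) (fun y => ?_) hw
  · exact (((measurePreserving_leftTranslation (lam := lam) x).comp
      (Measure.measurePreserving_neg (vol n))).lintegral_comp hψ_meas).le
  · exact ((measurePreserving_rightTranslation (lam := lam) (-y)).lintegral_comp hψ_meas).le

lemma integral_groupConv_mul {ψ w φ : H n → ℂ} (hψ : IsTest ψ)
    (hw : LocallyIntegrable w (vol n)) (hφ : IsTest φ) :
    ∫ x, groupConv lam ψ w x * φ x ∂vol n =
      ∫ g, ψ g * ∫ y, w y * φ (groupMul lam g y) ∂vol n ∂vol n := by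
  have hψc := hψ.1.continuous
  have hφc := hφ.1.continuous
  have hint : Integrable (fun p : H n × H n => w p.2 * (ψ (groupMul lam p.1 (-p.2)) * φ p.1))
      ((vol n).prod (vol n)) := by
    refine integrable_mul_kernel hw (by fun_prop) <| HasCompactSupport.intro
      ((hψ.2.isCompact.prod hφ.2.isCompact).image (f := fun p : H n × H n =>
        (p.2, groupMul lam (-p.1) p.2)) (by fun_prop)) fun p hp => ?_
    contrapose! hp
    exact ⟨(groupMul lam p.1 (-p.2), p.1), ⟨subset_tsupport ψ (left_ne_zero_of_mul hp),
      subset_tsupport φ (right_ne_zero_of_mul hp)⟩,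
      Prod.ext rfl (neg_groupMul_neg_groupMul p.1 p.2)⟩
  have hint' : Integrable (fun p : H n × H n => w p.2 * (ψ p.1 * φ (groupMul lam p.1 p.2)))
      ((vol n).prod (vol n)) := by
    refine integrable_mul_kernel hw (by fun_prop) <| HasCompactSupport.intro
      ((hψ.2.isCompact.prod hφ.2.isCompact).image (f := fun p : H n × H n =>
        (p.1, groupMul lam (-p.1) p.2)) (by fun_prop)) fun p hp => ?_
    contrapose! hp
    exact ⟨(p.1, groupMul lam p.1 p.2), ⟨subset_tsupport ψ (left_ne_zero_of_mul hp),
      subset_tsupport φ (right_ne_zero_of_mul hp)⟩,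
      Prod.ext rfl (neg_groupMul_groupMul p.1 p.2)⟩
  have hsubst : ∀ y, ∫ x, w y * (ψ (groupMul lam x (-y)) * φ x) ∂vol n =
      ∫ g, w y * (ψ g * φ (groupMul lam g y)) ∂vol n := fun y => by
    rw [← (measurePreserving_rightTranslation y).integral_comp
      (rightTranslation lam y).measurableEmbedding]
    simp [rightTranslation, groupMul_groupMul_neg]
  calc ∫ x, groupConv lam ψ w x * φ x ∂vol n
      = ∫ x, ∫ y, w y * (ψ (groupMul lam x (-y)) * φ x) ∂vol n ∂vol n := by
        simp only [groupConv, ← mul_assoc, integral_mul_const]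
    _ = ∫ y, ∫ g, w y * (ψ g * φ (groupMul lam g y)) ∂vol n ∂vol n := by
        rw [integral_integral_swap hint]
        simp only [hsubst]
    _ = ∫ g, ψ g * ∫ y, w y * φ (groupMul lam g y) ∂vol n ∂vol n := by
        rw [← integral_integral_swap hint']
        simp only [mul_left_comm (w _), integral_const_mul]

lemma IsWeaklyHarmonic.groupConv {c s : Fin n → ℝ} {ψ w : H n → ℂ}
    (hharm : IsWeaklyHarmonic lam c s w) (hψ : IsTest ψ) (hw : LocallyIntegrable w (vol n)) :
    IsWeaklyHarmonic lam c s (groupConv lam ψ w) := fun φ hφ => by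
  have hzero : ∀ g, ∫ y, w y * Heisenberg.weightedBox lam c s φ (groupMul lam g y) ∂vol n = 0 :=
    fun g => by
      simpa only [weightedBox_comp_groupMul hφ] using hharm _ (hφ.comp_groupMul (lam := lam) g)
  rw [integral_groupConv_mul hψ hw hφ.weightedBox]
  simp only [hzero, mul_zero, integral_zero]

lemma ae_eq_zero_of_forall_groupConv_eq_zero {w : H n → ℂ} (hw : LocallyIntegrable w (vol n))
    (h : ∀ ψ, IsTest ψ → groupConv lam ψ w = 0) : w =ᵐ[vol n] 0 := by
  refine ae_eq_zero_of_forall_integral_mul_test hw fun φ hφ => ?_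
  have hψ : IsTest fun x => φ (-x) :=
    ⟨hφ.1.comp contDiff_neg, hφ.2.comp_homeomorph (Homeomorph.neg (H n))⟩
  simpa [groupConv, zero_groupMul] using congrFun (h _ hψ) 0

/-- The alternative in the hypothesis lists the cases in which some positive combination of the
commutators `[A_k, A_k^*]`, which are multiples of `s_k λ_k T`, vanishes. -/
theorem IsWeaklyHarmonic.ae_eq_zero {s : Fin n → ℝ} {w : H n → ℂ}
    (hharm : IsWeaklyHarmonic lam 1 s w) (hw : MemLp w 2 (vol n))
    (hlam : (∃ j, lam j = 0) ∨ ∃ k l, 0 < s k * lam k ∧ s l * lam l < 0) :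
    w =ᵐ[vol n] 0 := by
  have hloc : LocallyIntegrable w (vol n) := hw.locallyIntegrable one_le_two
  refine ae_eq_zero_of_forall_groupConv_eq_zero (lam := lam) hloc fun ψ hψ => ?_
  have hf := contDiff_groupConv (lam := lam) hψ hloc
  have hf₂ := memLp_groupConv (lam := lam) hψ hw
  have hA : ∀ k, zField lam (s k) k (Heisenberg.groupConv lam ψ w) = 0 := fun k =>
    (hharm.groupConv hψ hloc).zField_eq_zero zero_le_one hf hf₂ zero_lt_one
  rcases hlam with ⟨j, hj⟩ | ⟨k, l, hk, hl⟩
  · exact eq_zero_of_forall_zField_eq_zero_of_lam_eq_zero hf hf₂ hA hj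
  · exact eq_zero_of_forall_zField_eq_zero_of_opposite_signs hf hf₂ hA hk hl

/-! ### Diagonalisation of the Kohn Laplacian -/

/-- The sign in `dz̄_k ∧ dz̄^J = ± dz̄^K` for `k ∈ K` and `J = K \ {k}`. -/
def wedgeSign (k : Fin n) (K : Finset (Fin n)) : ℂ :=
  (-1) ^ (K.filter (fun j => j < k)).card

lemma wedgeSign_mul_self (k : Fin n) (K : Finset (Fin n)) :
    wedgeSign k K * wedgeSign k K = 1 := by
  rw [wedgeSign, ← mul_pow, neg_mul_neg, one_mul, one_pow]

lemma wedgeSign_mul_wedgeSign_insert {J : Finset (Fin n)} {j k : Fin n} (hj : j ∈ J)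
    (hk : k ∉ J) :
    wedgeSign k (insert k J) * wedgeSign j (insert k J) =
      -(wedgeSign j J * wedgeSign k (insert k (J.erase j))) := by
  have hk_insert : (insert k J).filter (· < k) = J.filter (· < k) := by
    rw [Finset.filter_insert, if_neg (lt_irrefl k)]
  have hk_erase : (insert k (J.erase j)).filter (· < k) = (J.filter (· < k)).erase j := by
    rw [Finset.filter_insert, if_neg (lt_irrefl k), Finset.filter_erase]
  simp only [wedgeSign, hk_insert, hk_erase]
  rcases lt_or_gt_of_ne (ne_of_mem_of_not_mem hj hk) with h | h
  · have hmem : j ∈ J.filter (· < k) := Finset.mem_filter.2 ⟨hj, h⟩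
    rw [Finset.filter_insert, if_neg h.not_gt, ← Finset.card_erase_add_one hmem, pow_succ]
    ring
  · have hj_notMem : j ∉ J.filter (· < k) := fun hmem => lt_asymm h (Finset.mem_filter.1 hmem).2
    have hk_notMem : k ∉ J.filter (· < j) := fun hmem => hk (Finset.mem_filter.1 hmem).1
    rw [Finset.filter_insert, if_pos h, Finset.erase_eq_of_notMem hj_notMem,
      Finset.card_insert_of_notMem hk_notMem, pow_succ]
    ring

/-- The equation `∂̄_b (∑ U_J dz̄^J) = 0` in the sense of distributions, for coefficients of all
degrees at once. -/
def IsWeaklyClosed (lam : Fin n → ℝ) (U : Finset (Fin n) → H n → ℂ) : Prop :=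
  ∀ K φ, IsTest φ →
    ∑ k ∈ K, wedgeSign k K * ∫ x, U (K.erase k) x * zField lam 1 k φ x ∂vol n = 0

/-- The equation `∂̄_b^* (∑ U_J dz̄^J) = 0` in the sense of distributions, for coefficients of all
degrees at once. -/
def IsWeaklyCoclosed (lam : Fin n → ℝ) (U : Finset (Fin n) → H n → ℂ) : Prop :=
  ∀ I φ, IsTest φ → ∑ k ∈ Iᶜ, wedgeSign k (insert k I) *
    ∫ x, U (insert k I) x * zField lam (-1) k φ x ∂vol n = 0

/-- The sign `s_k` for which `A_k = (X_k + i s_k Y_k) / 2` is the field occurring in the `J`-th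
component `∑ A_k^* A_k` of the Kohn Laplacian: `A_k = Z_k` for `k ∈ J` and `A_k = conj Z_k`
otherwise. -/
def boxSign (J : Finset (Fin n)) (k : Fin n) : ℝ := if k ∈ J then -1 else 1

lemma boxSign_of_mem {J : Finset (Fin n)} {k : Fin n} (hk : k ∈ J) : boxSign J k = -1 :=
  if_pos hk

lemma boxSign_of_notMem {J : Finset (Fin n)} {k : Fin n} (hk : k ∉ J) : boxSign J k = 1 :=
  if_neg hk

/-- The `(j, k)` contribution of `U` to the `J`-th component of `∂̄_b^* ∂̄_b`, tested against `φ`.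
It occurs with the opposite sign in `∂̄_b ∂̄_b^*`. -/
def mixedTerm (lam : Fin n → ℝ) (U : Finset (Fin n) → H n → ℂ) (J : Finset (Fin n))
    (φ : H n → ℂ) (j k : Fin n) : ℂ :=
  wedgeSign j J * wedgeSign k (insert k (J.erase j)) *
    ∫ x, U (insert k (J.erase j)) x * zField lam 1 j (zField lam (-1) k φ) x ∂vol n

section Diagonalisation

variable {U : Finset (Fin n) → H n → ℂ} {J : Finset (Fin n)} {φ : H n → ℂ}

lemma IsWeaklyClosed.integral_eq_sum_mixedTerm (hU : IsWeaklyClosed lam U) (hφ : IsTest φ)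
    {k : Fin n} (hk : k ∉ J) :
    ∫ x, U J x * zField lam 1 k (zField lam (-1) k φ) x ∂vol n =
      ∑ j ∈ J, mixedTerm lam U J φ j k := by
  have hmixed : ∑ j ∈ J, mixedTerm lam U J φ j k =
      -(wedgeSign k (insert k J) * ∑ j ∈ J, wedgeSign j (insert k J) *
        ∫ x, U ((insert k J).erase j) x * zField lam 1 j (zField lam (-1) k φ) x ∂vol n) := by
    rw [Finset.mul_sum, ← Finset.sum_neg_distrib]
    refine Finset.sum_congr rfl fun j hj => ?_
    rw [Finset.erase_insert_of_ne (ne_of_mem_of_not_mem hj hk).symm, ← mul_assoc,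
      wedgeSign_mul_wedgeSign_insert hj hk, mixedTerm]
    ring
  have hclosed := hU (insert k J) _ (hφ.zField (lam := lam) (-1) k)
  rw [Finset.sum_insert hk, Finset.erase_insert hk] at hclosed
  rw [hmixed]
  linear_combination wedgeSign k (insert k J) * hclosed -
    (∫ x, U J x * zField lam 1 k (zField lam (-1) k φ) x ∂vol n) *
      wedgeSign_mul_self k (insert k J)

lemma IsWeaklyCoclosed.integral_eq_neg_sum_mixedTerm (hU : IsWeaklyCoclosed lam U)
    (hφ : IsTest φ) {j : Fin n} (hj : j ∈ J) :
    ∫ x, U J x * zField lam (-1) j (zField lam 1 j φ) x ∂vol n =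
      -∑ k ∈ Jᶜ, mixedTerm lam U J φ j k := by
  have hmixed : ∑ k ∈ Jᶜ, mixedTerm lam U J φ j k =
      wedgeSign j J * ∑ k ∈ Jᶜ, wedgeSign k (insert k (J.erase j)) *
        ∫ x, U (insert k (J.erase j)) x * zField lam (-1) k (zField lam 1 j φ) x ∂vol n := by
    rw [Finset.mul_sum]
    refine Finset.sum_congr rfl fun k hk => ?_
    rw [mixedTerm, mul_assoc, zField_comm_of_ne 1 (-1)
      (ne_of_mem_of_not_mem hj (Finset.mem_compl.1 hk)) hφ.contDiff]
  have hcoclosed := hU (J.erase j) _ (hφ.zField (lam := lam) 1 j)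
  rw [Finset.compl_erase, Finset.sum_insert (by simpa using hj), Finset.insert_erase hj]
    at hcoclosed
  rw [hmixed]
  linear_combination wedgeSign j J * hcoclosed -
    (∫ x, U J x * zField lam (-1) j (zField lam 1 j φ) x ∂vol n) * wedgeSign_mul_self j J

theorem IsWeaklyClosed.isWeaklyHarmonic (hU : IsWeaklyClosed lam U)
    (hU' : IsWeaklyCoclosed lam U) (hloc : LocallyIntegrable (U J) (vol n)) :
    IsWeaklyHarmonic lam 1 (boxSign J) (U J) := fun φ hφ => by
  have hJ : ∀ j ∈ J, ∫ x, U J x *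
      zField lam (boxSign J j) j (zField lam (-boxSign J j) j φ) x ∂vol n =
        -∑ k ∈ Jᶜ, mixedTerm lam U J φ j k := fun j hj => by
    simpa only [boxSign_of_mem hj, neg_neg] using hU'.integral_eq_neg_sum_mixedTerm hφ hj
  have hJc : ∀ k ∈ Jᶜ, ∫ x, U J x *
      zField lam (boxSign J k) k (zField lam (-boxSign J k) k φ) x ∂vol n =
        ∑ j ∈ J, mixedTerm lam U J φ j k := fun k hk => by
    rw [Finset.mem_compl] at hk
    simpa only [boxSign_of_notMem hk] using hU.integral_eq_sum_mixedTerm hφ hk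
  rw [integral_mul_weightedBox hloc hφ]
  simp only [Pi.one_apply, Complex.ofReal_one, one_mul]
  rw [← Finset.sum_add_sum_compl J, Finset.sum_congr rfl hJ, Finset.sum_congr rfl hJc,
    Finset.sum_comm (s := Jᶜ), Finset.sum_neg_distrib, neg_add_cancel]

end Diagonalisation

/-! ### Harmonic forms -/

section TestForms

variable {q : ℕ} {α : MultiIndex n q → H n → ℂ}

lemma memLp_toLp_coeff (hα : ∀ J, IsTest (α J)) :
    MemLp (fun x => (WithLp.toLp 2 (fun J => α J x) : Fibre n q)) 2 (vol n) :=
  MemLp.of_eval_piLp fun J => (hα J).memLp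

/-- The square integrable form `∑ α_J dz̄^J` with test functions `α_J` as coefficients. -/
def toForm (α : MultiIndex n q → H n → ℂ) (hα : ∀ J, IsTest (α J)) : L2Form n q :=
  (memLp_toLp_coeff hα).toLp _

lemma coeff_toForm (hα : ∀ J, IsTest (α J)) (J : MultiIndex n q) :
    coeff (toForm α hα) J =ᵐ[vol n] α J := by
  filter_upwards [(memLp_toLp_coeff hα).coeFn_toLp] with x hx
  rw [coeff, toForm, hx]

lemma integral_coeff_toForm_mul (hα : ∀ J, IsTest (α J)) (J : MultiIndex n q) (ψ : H n → ℂ) :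
    ∫ x, coeff (toForm α hα) J x * ψ x ∂vol n = ∫ x, α J x * ψ x ∂vol n :=
  integral_congr_ae ((coeff_toForm hα J).mul (EventuallyEq.refl _ ψ))

lemma IsTest.integrable_coeff_mul (u : L2Form n q) (J : MultiIndex n q) {φ : H n → ℂ}
    (hφ : IsTest φ) : Integrable (fun x => coeff u J x * φ x) (vol n) :=
  integrable_pair (memLp_coeff u J) hφ.1.continuous hφ.2

lemma inner_toForm (hα : ∀ J, IsTest (α J)) (u : L2Form n q) :
    inner ℂ (toForm α hα) u = ∑ J, ∫ x, coeff u J x * conj (α J x) ∂vol n := by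
  rw [L2.inner_def, ← integral_finsetSum _ fun J _ => (hα J).conjugate.integrable_coeff_mul u J]
  refine integral_congr_ae ?_
  filter_upwards [(memLp_toLp_coeff hα).coeFn_toLp] with x hx
  rw [toForm, hx, PiLp.inner_apply]
  rfl

lemma wedgeSum_apply {A X : Type*} (D : Fin n → A → X → ℂ) (u : MultiIndex n q → A)
    (K : MultiIndex n (q + 1)) (x : X) :
    wedgeSum D u K x = ∑ k : {k // k ∈ K.1}, wedgeSign k.1 K.1 * D k.1 (u (K.erase k)) x := by
  rw [wedgeSum, Finset.sum_apply]
  refine Finset.sum_congr rfl fun k _ => ?_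
  rw [Pi.smul_apply, zsmul_eq_mul, Int.cast_pow, Int.cast_neg, Int.cast_one, wedgeSign]

lemma dbarSmooth_apply (lam : Fin n → ℝ) (α : MultiIndex n q → H n → ℂ)
    (K : MultiIndex n (q + 1)) (x : H n) :
    dbarSmooth lam α K x =
      ∑ k : {k // k ∈ K.1}, wedgeSign k.1 K.1 * zField lam 1 k.1 (α (K.erase k)) x := by
  simp only [dbarSmooth, wedgeSum_apply, Zbar_eq_zField]

lemma isTest_dbarSmooth (hα : ∀ J, IsTest (α J)) (K : MultiIndex n (q + 1)) :
    IsTest (dbarSmooth lam α K) := by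
  rw [funext (dbarSmooth_apply lam α K)]
  exact IsTest.sum fun k _ =>
    ((hα (K.erase k)).zField 1 k.1).mul_left (f := fun _ => wedgeSign k.1 K.1) contDiff_const

lemma isWeakDbar_toForm (hα : ∀ J, IsTest (α J)) :
    IsWeakDbar lam (toForm α hα) (toForm (dbarSmooth lam α) (isTest_dbarSmooth hα)) := by
  intro K φ hφ
  rw [toDist, integral_coeff_toForm_mul, ← toDist, toDist_dbarSmooth lam (fun J => (hα J).1) K hφ]
  simp only [wedgeSum_apply, distZbar, integral_coeff_toForm_mul]

/-- The form `u`, with its coefficients extended by zero to sets of cardinality other than `q`. -/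
def coeffSet (u : L2Form n q) (S : Finset (Fin n)) : H n → ℂ :=
  if h : S.card = q then coeff u ⟨S, h⟩ else 0

lemma coeffSet_val (u : L2Form n q) (J : MultiIndex n q) : coeffSet u J.1 = coeff u J :=
  dif_pos J.2

lemma coeffSet_of_card_ne (u : L2Form n q) {S : Finset (Fin n)} (hS : S.card ≠ q) :
    coeffSet u S = 0 :=
  dif_neg hS

lemma sum_erase_eq_sum_insert (F : Fin n → Finset (Fin n) → MultiIndex n q → ℂ) :
    ∑ K : MultiIndex n (q + 1), ∑ k : {k // k ∈ K.1}, F k.1 K.1 (K.erase k) =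
      ∑ I : MultiIndex n q, ∑ k ∈ I.1ᶜ, F k (insert k I.1) I := by
  rw [Finset.sum_sigma', Finset.sum_sigma']
  refine Finset.sum_bij' (fun p _ => ⟨p.1.erase p.2, p.2.1⟩)
    (fun p hp => ⟨⟨insert p.2 p.1.1, ?_⟩, ⟨p.2, Finset.mem_insert_self _ _⟩⟩) ?_ ?_ ?_ ?_ ?_
  · rw [Finset.card_insert_of_notMem (by simpa using hp), p.1.2]
  · simp [MultiIndex.erase]
  · simp
  · rintro ⟨K, k⟩ -
    exact Sigma.subtype_ext (Subtype.ext (Finset.insert_erase k.2)) rfl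
  · rintro ⟨I, k⟩ hk
    have hkI : k ∉ I.1 := by simpa using hk
    simp [MultiIndex.erase, Finset.erase_insert hkI]
  · rintro ⟨K, k⟩ -
    simp [MultiIndex.erase, Finset.insert_erase k.2]

lemma integral_coeff_mul_conj_dbarSmooth (hα : ∀ J, IsTest (α J)) (u : L2Form n (q + 1))
    (K : MultiIndex n (q + 1)) :
    ∫ x, coeff u K x * conj (dbarSmooth lam α K x) ∂vol n =
      ∑ k : {k // k ∈ K.1}, wedgeSign k.1 K.1 * ∫ x, coeff u K x *
        zField lam (-1) k.1 (fun y => conj (α (K.erase k) y)) x ∂vol n := by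
  have hconj : ∀ x, coeff u K x * conj (dbarSmooth lam α K x) =
      ∑ k : {k // k ∈ K.1}, wedgeSign k.1 K.1 *
        (coeff u K x * zField lam (-1) k.1 (fun y => conj (α (K.erase k) y)) x) := fun x => by
    rw [dbarSmooth_apply, map_sum, Finset.mul_sum]
    refine Finset.sum_congr rfl fun k _ => ?_
    rw [zField_conj _ _ ((hα _).differentiable x), neg_neg, map_mul, mul_left_comm, wedgeSign,
      map_pow, map_neg, map_one]
  simp only [hconj, ← integral_const_mul]
  exact integral_finsetSum _ fun k _ =>
    (((hα _).conjugate.zField (-1) k.1).integrable_coeff_mul u K).const_mul _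

lemma inner_toForm_dbarSmooth (hα : ∀ J, IsTest (α J)) (u : L2Form n (q + 1)) :
    inner ℂ (toForm (dbarSmooth lam α) (isTest_dbarSmooth hα)) u =
      ∑ I : MultiIndex n q, ∑ k ∈ I.1ᶜ, wedgeSign k (insert k I.1) *
        ∫ x, coeffSet u (insert k I.1) x *
          zField lam (-1) k (fun y => conj (α I y)) x ∂vol n := by
  rw [inner_toForm, ← sum_erase_eq_sum_insert fun k K I => wedgeSign k K *
    ∫ x, coeffSet u K x * zField lam (-1) k (fun y => conj (α I y)) x ∂vol n]
  simp only [integral_coeff_mul_conj_dbarSmooth hα, coeffSet_val]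

lemma isTest_single (J : MultiIndex n q) {φ : H n → ℂ} (hφ : IsTest φ) (I : MultiIndex n q) :
    IsTest ((Pi.single J φ : MultiIndex n q → H n → ℂ) I) := by
  obtain rfl | h := eq_or_ne I J
  · rwa [Pi.single_eq_same]
  · rw [Pi.single_eq_of_ne h]
    exact IsTest.zero

end TestForms

section Orthogonality

variable {q : ℕ}

lemma isWeaklyClosed_coeffSet {u : L2Form n q} (hu : IsWeakDbar lam u 0) :
    IsWeaklyClosed lam (coeffSet u) := by
  intro K φ hφ
  by_cases hK : K.card = q + 1
  · have hzero : toDist (coeff (0 : L2Form n (q + 1)) ⟨K, hK⟩) φ = 0 := by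
      simpa only [zero_smul, zero_mul, toDist] using
        integral_coeff_smul 0 (0 : L2Form n (q + 1)) ⟨K, hK⟩ φ
    have hweak := (hu ⟨K, hK⟩ φ hφ).trans hzero
    rw [← Finset.sum_coe_sort, ← neg_eq_zero, ← hweak, wedgeSum_apply,
      ← Finset.sum_neg_distrib]
    refine Finset.sum_congr rfl fun k _ => ?_
    rw [show K.erase k = (MultiIndex.erase ⟨K, hK⟩ k).1 from rfl, coeffSet_val, distZbar,
      Zbar_eq_zField, mul_neg]
  · refine Finset.sum_eq_zero fun k hk => ?_
    have hcard : (K.erase k).card ≠ q := fun h => hK (by rw [← h, Finset.card_erase_add_one hk])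
    simp only [coeffSet_of_card_ne u hcard, Pi.zero_apply, zero_mul, integral_zero, mul_zero]

lemma isWeaklyCoclosed_coeffSet_zero (u : L2Form n 0) : IsWeaklyCoclosed lam (coeffSet u) := by
  intro I φ _
  refine Finset.sum_eq_zero fun k _ => ?_
  have hcard : (insert k I).card ≠ 0 := Finset.card_ne_zero.2 (Finset.insert_nonempty k I)
  simp only [coeffSet_of_card_ne u hcard, Pi.zero_apply, zero_mul, integral_zero, mul_zero]

lemma isWeaklyCoclosed_coeffSet {u : L2Form n (q + 1)}
    (hu : ∀ (v : L2Form n q) (w : L2Form n (q + 1)), IsWeakDbar lam v w → inner ℂ w u = 0) :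
    IsWeaklyCoclosed lam (coeffSet u) := by
  intro I φ hφ
  by_cases hI : I.card = q
  · have hα := isTest_single ⟨I, hI⟩ hφ.conjugate
    have horth := hu _ _ (isWeakDbar_toForm hα)
    rw [inner_toForm_dbarSmooth hα, Finset.sum_eq_single_of_mem ⟨I, hI⟩ (Finset.mem_univ _)]
      at horth
    · simpa only [Pi.single_eq_same, Complex.conj_conj] using horth
    · intro J _ hJ
      have hzero : (fun y => conj ((Pi.single ⟨I, hI⟩ (fun x => conj (φ x)) :
          MultiIndex n q → H n → ℂ) J y)) = 0 := by
        funext y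
        rw [Pi.single_eq_of_ne hJ, Pi.zero_apply, map_zero]
      simp only [hzero, zField_zero, Pi.zero_apply, mul_zero, integral_zero,
        Finset.sum_const_zero]
  · refine Finset.sum_eq_zero fun k hk => ?_
    have hcard : (insert k I).card ≠ q + 1 := by
      rw [Finset.card_insert_of_notMem (Finset.mem_compl.1 hk)]
      exact fun h => hI (Nat.succ_injective h)
    simp only [coeffSet_of_card_ne u hcard, Pi.zero_apply, zero_mul, integral_zero, mul_zero]

end Orthogonality

section Hilbert

variable {E F G : Type*} [NormedAddCommGroup E] [InnerProductSpace ℂ E]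
  [NormedAddCommGroup F] [InnerProductSpace ℂ F] [NormedAddCommGroup G] [InnerProductSpace ℂ G]

lemma pcomp_domain_le (g : F →ₗ.[ℂ] G) (f : E →ₗ.[ℂ] F) : (pcomp g f).domain ≤ f.domain :=
  fun _ hx => hx.2

lemma inner_pcomp_self {S : F →ₗ.[ℂ] E} {T : E →ₗ.[ℂ] F} (h : S.IsFormalAdjoint T)
    (x : (pcomp S T).domain) :
    inner ℂ (pcomp S T x) x.1 = (‖T ⟨x.1, pcomp_domain_le S T x.2⟩‖ : ℂ) ^ 2 := by
  obtain ⟨_, ⟨y, hy, rfl⟩, _⟩ := x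
  exact (h ⟨T y, hy⟩ y).trans (inner_self_eq_norm_sq_to_K _)

lemma eq_zero_of_pcomp_eq_zero {S : F →ₗ.[ℂ] E} {T : E →ₗ.[ℂ] F} (h : S.IsFormalAdjoint T)
    {x : (pcomp S T).domain} (hx : pcomp S T x = 0) : T ⟨x.1, pcomp_domain_le S T x.2⟩ = 0 := by
  have hinner := inner_pcomp_self h x
  rwa [hx, inner_zero_left, eq_comm, sq_eq_zero_iff, Complex.ofReal_eq_zero, norm_eq_zero]
    at hinner

lemma eq_zero_of_pcomp_add_pcomp_eq_zero {S : F →ₗ.[ℂ] E} {T : E →ₗ.[ℂ] F}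
    (h : S.IsFormalAdjoint T) {S' : G →ₗ.[ℂ] E} {T' : E →ₗ.[ℂ] G} (h' : S'.IsFormalAdjoint T')
    {x : (pcomp S T + pcomp S' T').domain} (hx : (pcomp S T + pcomp S' T') x = 0) :
    T ⟨x.1, pcomp_domain_le S T x.2.1⟩ = 0 ∧ T' ⟨x.1, pcomp_domain_le S' T' x.2.2⟩ = 0 := by
  have hsum : inner ℂ (pcomp S T ⟨x.1, x.2.1⟩ + pcomp S' T' ⟨x.1, x.2.2⟩) x.1 = 0 := by
    rw [← LinearPMap.add_apply, hx, inner_zero_left]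
  rw [inner_add_left, inner_pcomp_self h ⟨x.1, x.2.1⟩, inner_pcomp_self h' ⟨x.1, x.2.2⟩] at hsum
  norm_cast at hsum
  rwa [add_eq_zero_iff_of_nonneg (sq_nonneg _) (sq_nonneg _), sq_eq_zero_iff, sq_eq_zero_iff,
    norm_eq_zero, norm_eq_zero] at hsum

end Hilbert

section Operator

variable {q : ℕ}

lemma isWeakDbar_dbar (u : (dbar lam q).domain) : IsWeakDbar lam u.1 (dbar lam q u) :=
  Submodule.mem_graph_toLinearPMap (dbarGraph_unique lam q) u

lemma isWeakDbar_zero_of_dbar_eq_zero {u : (dbar lam q).domain} (h : dbar lam q u = 0) :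
    IsWeakDbar lam u.1 0 :=
  h ▸ isWeakDbar_dbar u

lemma exists_dbar_eq {u : L2Form n q} {v : L2Form n (q + 1)} (h : IsWeakDbar lam u v) :
    ∃ hu : u ∈ (dbar lam q).domain, dbar lam q ⟨u, hu⟩ = v := by
  have hgraph : (u, v) ∈ (dbar lam q).graph := by
    rwa [dbar, Submodule.toLinearPMap_graph_eq _ (dbarGraph_unique lam q)]
  obtain ⟨y, rfl, rfl⟩ := (LinearPMap.mem_graph_iff _).1 hgraph
  exact ⟨y.2, rfl⟩

lemma eq_zero_of_forall_coeff_ae_eq_zero {u : L2Form n q}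
    (h : ∀ J, coeff u J =ᵐ[vol n] 0) : u = 0 := by
  rw [Lp.eq_zero_iff_ae_eq_zero]
  filter_upwards [ae_all_iff.2 h] with x hx
  ext J
  exact hx J

lemma locallyIntegrable_coeff (u : L2Form n q) (J : MultiIndex n q) :
    LocallyIntegrable (coeff u J) (vol n) :=
  (memLp_coeff u J).locallyIntegrable one_le_two

lemma dense_dbar_domain (lam : Fin n → ℝ) (q : ℕ) :
    Dense ((dbar lam q).domain : Set (L2Form n q)) := by
  rw [Submodule.dense_iff_topologicalClosure_eq_top, Submodule.topologicalClosure_eq_top_iff,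
    Submodule.eq_bot_iff]
  intro u hu
  refine eq_zero_of_forall_coeff_ae_eq_zero fun J =>
    ae_eq_zero_of_forall_integral_mul_test (locallyIntegrable_coeff u J) fun φ hφ => ?_
  have hα := isTest_single J hφ.conjugate
  obtain ⟨hmem, -⟩ := exists_dbar_eq (lam := lam) (isWeakDbar_toForm hα)
  have horth := (Submodule.mem_orthogonal _ _).1 hu _ hmem
  rw [inner_toForm, Finset.sum_eq_single_of_mem J (Finset.mem_univ J)] at horth
  · simpa only [Pi.single_eq_same, Complex.conj_conj] using horth
  · intro I _ hI
    simp only [Pi.single_eq_of_ne hI, Pi.zero_apply, map_zero, mul_zero, integral_zero]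

lemma dbarStar_isFormalAdjoint (lam : Fin n → ℝ) (q : ℕ) :
    (dbarStar lam q).IsFormalAdjoint (dbar lam q) :=
  LinearPMap.adjoint_isFormalAdjoint (dense_dbar_domain lam q)

lemma isWeakDbar_zero_of_mem_harmonicSpace {u : L2Form n q} (hu : u ∈ harmonicSpace lam q) :
    IsWeakDbar lam u 0 := by
  obtain ⟨v, hv, rfl⟩ := hu
  cases q with
  | zero =>
    exact isWeakDbar_zero_of_dbar_eq_zero (u := ⟨v.1, v.2.2⟩)
      (eq_zero_of_pcomp_eq_zero (dbarStar_isFormalAdjoint lam 0) (x := v) hv)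
  | succ q =>
    exact isWeakDbar_zero_of_dbar_eq_zero (u := ⟨v.1, v.2.2.2⟩)
      (eq_zero_of_pcomp_add_pcomp_eq_zero (dbarStar_isFormalAdjoint lam q).symm
        (dbarStar_isFormalAdjoint lam (q + 1)) (x := v) hv).2

lemma inner_eq_zero_of_mem_harmonicSpace {u : L2Form n (q + 1)}
    (hu : u ∈ harmonicSpace lam (q + 1)) {v : L2Form n q} {w : L2Form n (q + 1)}
    (h : IsWeakDbar lam v w) : inner ℂ w u = 0 := by
  obtain ⟨u, hu, rfl⟩ := hu
  obtain ⟨hv, rfl⟩ := exists_dbar_eq h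
  have hstar := (eq_zero_of_pcomp_add_pcomp_eq_zero (dbarStar_isFormalAdjoint lam q).symm
      (dbarStar_isFormalAdjoint lam (q + 1)) hu).1
  have hadj := (dbarStar_isFormalAdjoint lam q).symm ⟨v, hv⟩ ⟨u.1, pcomp_domain_le _ _ u.2.1⟩
  rwa [hstar, inner_zero_right] at hadj

lemma isWeaklyCoclosed_of_mem_harmonicSpace {u : L2Form n q} (hu : u ∈ harmonicSpace lam q) :
    IsWeaklyCoclosed lam (coeffSet u) := by
  cases q with
  | zero => exact isWeaklyCoclosed_coeffSet_zero u
  | succ q => exact isWeaklyCoclosed_coeffSet fun _ _ h => inner_eq_zero_of_mem_harmonicSpace hu h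

theorem harmonicSpace_eq_bot (h : ∀ J : MultiIndex n q, (∃ j, lam j = 0) ∨
    ∃ k l, 0 < boxSign J.1 k * lam k ∧ boxSign J.1 l * lam l < 0) :
    harmonicSpace lam q = ⊥ := by
  refine (Submodule.eq_bot_iff _).2 fun u hu => eq_zero_of_forall_coeff_ae_eq_zero fun J => ?_
  have hclosed := isWeaklyClosed_coeffSet (isWeakDbar_zero_of_mem_harmonicSpace hu)
  have hharm := hclosed.isWeaklyHarmonic (J := J.1) (isWeaklyCoclosed_of_mem_harmonicSpace hu)
  rw [coeffSet_val] at hharm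
  exact (hharm (locallyIntegrable_coeff u J)).ae_eq_zero (memLp_coeff u J) (h J)

end Operator

lemma exists_boxSign_mul_pos (hlam : ∀ j, lam j ≠ 0) {J : Finset (Fin n)}
    (hJ : J.card ≠ (Finset.univ.filter fun j => 0 < lam j).card) :
    ∃ k, 0 < boxSign J k * lam k := by
  by_contra! hle
  refine hJ (congrArg Finset.card (Finset.ext fun k => ?_))
  have hk := hle k
  rw [Finset.mem_filter_univ]
  by_cases hkJ : k ∈ J
  · rw [boxSign_of_mem hkJ] at hk
    exact iff_of_true hkJ ((hlam k).symm.lt_of_le (by linarith))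
  · rw [boxSign_of_notMem hkJ] at hk
    exact iff_of_false hkJ (by linarith)

lemma exists_boxSign_mul_neg (hlam : ∀ j, lam j ≠ 0) {J : Finset (Fin n)}
    (hJ : J.card ≠ (Finset.univ.filter fun j => lam j < 0).card) :
    ∃ k, boxSign J k * lam k < 0 := by
  obtain ⟨k, hk⟩ := exists_boxSign_mul_pos (lam := -lam) (fun j => neg_ne_zero.2 (hlam j))
    (J := J) (by simpa only [Pi.neg_apply, Left.neg_pos_iff] using hJ)
  exact ⟨k, by simpa only [Pi.neg_apply, mul_neg, Left.neg_pos_iff] using hk⟩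

end Heisenberg

end

theorem theorem1p1 (n : ℕ) (lam : Fin n → ℝ) (q : ℕ) :
    ((∃ j, lam j = 0) → Heisenberg.harmonicSpace lam q = ⊥) ∧
    ((∀ j, lam j ≠ 0) →
      q ∉ ({(Finset.univ.filter (fun j => lam j < 0)).card,
            (Finset.univ.filter (fun j => 0 < lam j)).card} : Set ℕ) →
      Heisenberg.harmonicSpace lam q = ⊥) := by
  refine ⟨fun hzero => Heisenberg.harmonicSpace_eq_bot fun _ => Or.inl hzero,
    fun hlam hq => Heisenberg.harmonicSpace_eq_bot fun J => Or.inr ?_⟩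
  rw [Set.mem_insert_iff, Set.mem_singleton_iff, not_or, ← J.2] at hq
  obtain ⟨k, hk⟩ := Heisenberg.exists_boxSign_mul_pos hlam hq.2
  obtain ⟨l, hl⟩ := Heisenberg.exists_boxSign_mul_neg hlam hq.1
  exact ⟨k, l, hk, hl⟩
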